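/- Let $\mathbb{K}$ be a field. An extended diassociative semigroup (EDS) is a set $\Omega$ with four products $\leftarrow,\rightarrow,\triangleleft,\triangleright:\Omega\times\Omega\to\Omega$ such that, for all $\alpha,\beta,\gamma\in\Omega$: \begin{align*} &(\alpha\leftarrow\beta)\leftarrow\gamma=\alpha\leftarrow(\beta\leftarrow\gamma)=\alpha\leftarrow(\beta\rightarrow\gamma),\qquad (\alpha\rightarrow\beta)\leftarrow\gamma=\alpha\rightarrow(\beta\leftarrow\gamma),\\ &(\alpha\rightarrow\beta)\rightarrow\gamma=(\alpha\leftarrow\beta)\rightarrow\gamma=\alpha\rightarrow(\beta\rightarrow\gamma),\\ &\alpha\triangleright(\beta\leftarrow\gamma)=\alpha\triangleright\beta,\qquad (\alpha\rightarrow\beta)\triangleleft\gamma=\beta\triangleleft\gamma,\\ &(\alpha\triangleleft\beta)\leftarrow((\alpha\leftarrow\beta)\triangleleft\gamma)=\alpha\triangleleft(\beta\leftarrow\gamma),\qquad (\alpha\triangleleft\beta)\triangleleft((\alpha\leftarrow\beta)\triangleleft\gamma)=\beta\triangleleft\gamma,\\ &(\alpha\triangleleft\beta)\rightarrow((\alpha\leftarrow\beta)\triangleleft\gamma)=\alpha\triangleleft(\beta\rightarrow\gamma),\qquad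 (\alpha\triangleleft\beta)\triangleright((\alpha\leftarrow\beta)\triangleleft\gamma)=\beta\triangleright\gamma,\\ &(\alpha\triangleright(\beta\rightarrow\gamma))\leftarrow(\beta\triangleright\gamma)=(\alpha\leftarrow\beta)\triangleright\gamma,\qquad (\alpha\triangleright(\beta\rightarrow\gamma))\triangleleft(\beta\triangleright\gamma)=\alpha\triangleleft\beta,\\ &(\alpha\triangleright(\beta\rightarrow\gamma))\rightarrow(\beta\triangleright\gamma)=(\alpha\rightarrow\beta)\triangleright\gamma,\qquad (\alpha\triangleright(\beta\rightarrow\gamma))\triangleright(\beta\triangleright\gamma)=\alpha\triangleright\beta. \end{align*} It is nondegenerate if the maps $\Omega^2\to\Omega^2$, $(\alpha,\beta)\mapsto(\alpha\leftarrow\beta,\alpha\triangleleft\beta)$ and $(\alpha,\beta)\mapsto(\alpha\rightarrow\beta,\alpha\triangleright\beta)$ are both bijective. Let $\mathcal{T}^+_\Omega$ be the set of plane binary trees with at least one internal vertex, whose internal edges are each given a type in $\Omega$. Let $|$ be the trivial tree and $Y$ the tree with one internal vertex. Write $T_1\bigvee_{\alpha,\beta}T_2$ for the tree whose root has left subtree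 $T_1$, attached by an edge of type $\alpha$, and right subtree $T_2$, attached by an edge of type $\beta$; by convention $\alpha=\emptyset$ (no type) if $T_1=|$, and $\beta=\emptyset$ if $T_2=|$. The vector space $\mathbb{K}\mathcal{T}^+_\Omega$ with basis $\mathcal{T}^+_\Omega$ carries the bilinear products $\prec_\alpha,\succ_\alpha$ ($\alpha\in\Omega$) defined recursively by \begin{align*} \left(T_1\textstyle\bigvee_{\alpha,\beta}T_2\right)\prec_\gamma T&=T_1\textstyle\bigvee_{\alpha,\beta\leftarrow\gamma}(T_2\prec_{\beta\triangleleft\gamma}T)+T_1\textstyle\bigvee_{\alpha,\beta\rightarrow\gamma}(T_2\succ_{\beta\triangleright\gamma}T)&&(T_2\neq|),\\ \left(T_1\textstyle\bigvee_{\alpha,\emptyset}|\right)\prec_\gamma T&=T_1\textstyle\bigvee_{\alpha,\gamma}T,\\ T\succ_\alpha\left(T_1\textstyle\bigvee_{\beta,\gamma}T_2\right)&=(T\succ_{\alpha\triangleright\beta}T_1)\textstyle\bigvee_{\alpha\rightarrow\beta,\gamma}T_2+(T\prec_{\alpha\triangleleft\beta}T_1)\textstyle\bigvee_{\alpha\leftarrow\beta,\gamma}T_2&&(T_1\neq|),\\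 T\succ_\alpha\left(|\textstyle\bigvee_{\emptyset,\gamma}T_2\right)&=T\textstyle\bigvee_{\alpha,\gamma}T_2. \end{align*} Let $\mathbb{K}\Omega$ be the vector space with basis $\Omega$, and equip $\mathbb{K}\Omega\otimes\mathbb{K}\mathcal{T}^+_\Omega$ with the bilinear products given, for $\alpha,\beta\in\Omega$ and $x,y\in\mathbb{K}\mathcal{T}^+_\Omega$, by \[(\alpha\otimes x)\prec(\beta\otimes y)=(\alpha\leftarrow\beta)\otimes(x\prec_{\alpha\triangleleft\beta}y),\qquad(\alpha\otimes x)\succ(\beta\otimes y)=(\alpha\rightarrow\beta)\otimes(x\succ_{\alpha\triangleright\beta}y).\] A dendriform algebra is a vector space $A$ with bilinear products $\prec,\succ$ such that, with $\cdot=\prec+\succ$, one has $(x\prec y)\prec z=x\prec(y\cdot z)$, $(x\succ y)\prec z=x\succ(y\prec z)$ and $(x\cdot y)\succ z=x\succ(y\succ z)$ for all $x,y,z\in A$. A dendriform bialgebra is a dendriform algebra $A$ with a coassociative (not necessarily counitary) linear coproduct $\Delta:A\to A\otimes A$, written $\Delta(a)=a'\otimes a''$, such that for all $x,y\in A$: \begin{align*}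 \Delta(x\prec y)&=x\otimes y+x'\prec y\otimes x''+x'\otimes x''\cdot y+x\prec y'\otimes y''+x'\prec y'\otimes x''\cdot y'',\\ \Delta(x\succ y)&=y\otimes x+x'\succ y\otimes x''+y'\otimes x\cdot y''+x\succ y'\otimes y''+x'\succ y'\otimes x''\cdot y''. \end{align*} **Proposition.** If $\Omega$ is a nondegenerate EDS, there exists a unique coproduct $\Delta$ on $\mathbb{K}\Omega\otimes\mathbb{K}\mathcal{T}^+_\Omega$ making $(\mathbb{K}\Omega\otimes\mathbb{K}\mathcal{T}^+_\Omega,\prec,\succ,\Delta)$ a dendriform bialgebra and such that $\Delta(\alpha\otimes Y)=0$ for all $\alpha\in\Omega$. Moreover, this dendriform bialgebra is graded by the number of internal vertices: if $A_n$ is the span of the $\alpha\otimes T$ where $\alpha\in\Omega$ and $T\in\mathcal{T}^+_\Omega$ has $n$ internal vertices, then $\mathbb{K}\Omega\otimes\mathbb{K}\mathcal{T}^+_\Omega=\bigoplus_n A_n$, $A_m\prec A_n\subseteq A_{m+n}$, $A_m\succ A_n\subseteq A_{m+n}$ and $\Delta(A_n)\subseteq\sum_{i+j=n}A_i\otimes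 A_j$. -/

import Mathlib

open scoped TensorProduct

noncomputable section

/-- A set `Ω` with four products: `la` is `←`, `ra` is `→`, `lt` is `◁` and `rt` is `▷`. -/
class FourProducts (Ω : Type*) where
  la : Ω → Ω → Ω
  ra : Ω → Ω → Ω
  lt : Ω → Ω → Ω
  rt : Ω → Ω → Ω

infixl:70 " ↼ " => FourProducts.la
infixl:70 " ⇀ " => FourProducts.ra
infixl:70 " ◁ₑ " => FourProducts.lt
infixl:70 " ▷ₑ " => FourProducts.rt

/-- Extended diassociative semigroups. The first five axioms say that `(Ω, ←, →)` is a
diassociative semigroup. -/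
class EDS (Ω : Type*) extends FourProducts Ω where
  la_assoc : ∀ α β γ : Ω, (α ↼ β) ↼ γ = α ↼ (β ↼ γ)
  la_la_eq_la_ra : ∀ α β γ : Ω, α ↼ (β ↼ γ) = α ↼ (β ⇀ γ)
  ra_la_assoc : ∀ α β γ : Ω, (α ⇀ β) ↼ γ = α ⇀ (β ↼ γ)
  ra_ra_eq_la_ra : ∀ α β γ : Ω, (α ⇀ β) ⇀ γ = (α ↼ β) ⇀ γ
  la_ra_eq_ra_ra : ∀ α β γ : Ω, (α ↼ β) ⇀ γ = α ⇀ (β ⇀ γ)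
  rt_la : ∀ α β γ : Ω, α ▷ₑ (β ↼ γ) = α ▷ₑ β
  ra_lt : ∀ α β γ : Ω, (α ⇀ β) ◁ₑ γ = β ◁ₑ γ
  lt_la : ∀ α β γ : Ω, (α ◁ₑ β) ↼ ((α ↼ β) ◁ₑ γ) = α ◁ₑ (β ↼ γ)
  lt_lt : ∀ α β γ : Ω, (α ◁ₑ β) ◁ₑ ((α ↼ β) ◁ₑ γ) = β ◁ₑ γ
  lt_ra : ∀ α β γ : Ω, (α ◁ₑ β) ⇀ ((α ↼ β) ◁ₑ γ) = α ◁ₑ (β ⇀ γ)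
  lt_rt : ∀ α β γ : Ω, (α ◁ₑ β) ▷ₑ ((α ↼ β) ◁ₑ γ) = β ▷ₑ γ
  rt_la_rt : ∀ α β γ : Ω, (α ▷ₑ (β ⇀ γ)) ↼ (β ▷ₑ γ) = (α ↼ β) ▷ₑ γ
  rt_lt_rt : ∀ α β γ : Ω, (α ▷ₑ (β ⇀ γ)) ◁ₑ (β ▷ₑ γ) = α ◁ₑ β
  rt_ra_rt : ∀ α β γ : Ω, (α ▷ₑ (β ⇀ γ)) ⇀ (β ▷ₑ γ) = (α ⇀ β) ▷ₑ γ
  rt_rt_rt : ∀ α β γ : Ω, (α ▷ₑ (β ⇀ γ)) ▷ₑ (β ▷ₑ γ) = α ▷ₑ β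

/-- The map `φ_← : (α, β) ↦ (α ← β, α ◁ β)`. -/
def phiLeft (Ω : Type*) [FourProducts Ω] (p : Ω × Ω) : Ω × Ω := (p.1 ↼ p.2, p.1 ◁ₑ p.2)

/-- The map `φ_→ : (α, β) ↦ (α → β, α ▷ β)`. -/
def phiRight (Ω : Type*) [FourProducts Ω] (p : Ω × Ω) : Ω × Ω := (p.1 ⇀ p.2, p.1 ▷ₑ p.2)

/-- Nondegeneracy: both `φ_←` and `φ_→` are bijective. -/
def EDS.Nondegenerate (Ω : Type*) [EDS Ω] : Prop :=
  Function.Bijective (phiLeft Ω) ∧ Function.Bijective (phiRight Ω)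

/-- Plane binary trees with at least one internal vertex, whose internal edges carry a type in `Ω`.
The four constructors distinguish whether the left and right subtrees at the root are trivial (a
leaf) or not; an edge to a leaf is not internal and carries no type. -/
inductive TypedTree (Ω : Type*) where
  /-- the tree with exactly one internal vertex -/
  | vertex : TypedTree Ω
  /-- left subtree `T₁`, attached by an edge of type `α`; the right subtree is a leaf -/
  | left (T₁ : TypedTree Ω) (α : Ω) : TypedTree Ω
  /-- right subtree `T₂`, attached by an edge of type `β`; the left subtree is a leaf -/
  | right (β : Ω) (T₂ : TypedTree Ω) : TypedTree Ω
  /-- left subtree `T₁` and right subtree `T₂`, attached by edges of types `α` and `β` -/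
  | both (T₁ : TypedTree Ω) (α β : Ω) (T₂ : TypedTree Ω) : TypedTree Ω

namespace TypedTree

/-- The number of internal vertices. -/
def numVertices {Ω : Type*} : TypedTree Ω → ℕ
  | vertex => 1
  | left T₁ _ => T₁.numVertices + 1
  | right _ T₂ => T₂.numVertices + 1
  | both T₁ _ _ T₂ => T₁.numVertices + T₂.numVertices + 1

mutual

/-- The product `S ≺_γ T` of two trees, a linear combination of trees. -/
def prec (K : Type*) [Field K] {Ω : Type*} [FourProducts Ω] (γ : Ω) (S T : TypedTree Ω) :
    TypedTree Ω →₀ K :=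
  match S with
  | vertex => Finsupp.single (right γ T) 1
  | left T₁ α => Finsupp.single (both T₁ α γ T) 1
  | right β T₂ =>
      Finsupp.mapDomain (fun U => right (β ↼ γ) U) (prec K (β ◁ₑ γ) T₂ T)
        + Finsupp.mapDomain (fun U => right (β ⇀ γ) U) (succ K (β ▷ₑ γ) T₂ T)
  | both T₁ α β T₂ =>
      Finsupp.mapDomain (fun U => both T₁ α (β ↼ γ) U) (prec K (β ◁ₑ γ) T₂ T)
        + Finsupp.mapDomain (fun U => both T₁ α (β ⇀ γ) U) (succ K (β ▷ₑ γ) T₂ T)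
termination_by S.numVertices + T.numVertices
decreasing_by all_goals (simp only [numVertices]; omega)

/-- The product `S ≻_α T` of two trees, a linear combination of trees. -/
def succ (K : Type*) [Field K] {Ω : Type*} [FourProducts Ω] (α : Ω) (S T : TypedTree Ω) :
    TypedTree Ω →₀ K :=
  match T with
  | vertex => Finsupp.single (left S α) 1
  | right γ T₂ => Finsupp.single (both S α γ T₂) 1
  | left T₁ β =>
      Finsupp.mapDomain (fun U => left U (α ⇀ β)) (succ K (α ▷ₑ β) S T₁)
        + Finsupp.mapDomain (fun U => left U (α ↼ β)) (prec K (α ◁ₑ β) S T₁)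
  | both T₁ β γ T₂ =>
      Finsupp.mapDomain (fun U => both U (α ⇀ β) γ T₂) (succ K (α ▷ₑ β) S T₁)
        + Finsupp.mapDomain (fun U => both U (α ↼ β) γ T₂) (prec K (α ◁ₑ β) S T₁)
termination_by S.numVertices + T.numVertices
decreasing_by all_goals (simp only [numVertices]; omega)

end

/-- The bilinear extension of `≺_γ` to the vector space generated by the trees. -/
def precLin (K : Type*) [Field K] {Ω : Type*} [FourProducts Ω] (γ : Ω) :
    (TypedTree Ω →₀ K) →ₗ[K] (TypedTree Ω →₀ K) →ₗ[K] (TypedTree Ω →₀ K) :=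
  Finsupp.linearCombination K fun S => Finsupp.linearCombination K fun T => prec K γ S T

/-- The bilinear extension of `≻_α` to the vector space generated by the trees. -/
def succLin (K : Type*) [Field K] {Ω : Type*} [FourProducts Ω] (α : Ω) :
    (TypedTree Ω →₀ K) →ₗ[K] (TypedTree Ω →₀ K) →ₗ[K] (TypedTree Ω →₀ K) :=
  Finsupp.linearCombination K fun S => Finsupp.linearCombination K fun T => succ K α S T

end TypedTree

/-- For maps `op, tp : Ω × Ω → Ω` and a family `(p_ω)` of bilinear products on `A`, the bilinear
product on `KΩ ⊗ A` given by `(α ⊗ x) * (β ⊗ y) = op α β ⊗ p_{tp α β} (x, y)`. -/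
def typedTensorProduct {K : Type*} [Field K] {Ω : Type*} {A : Type*} [AddCommGroup A] [Module K A]
    (op tp : Ω → Ω → Ω) (p : Ω → A →ₗ[K] A →ₗ[K] A) :
    ((Ω →₀ K) ⊗[K] A) →ₗ[K] ((Ω →₀ K) ⊗[K] A) →ₗ[K] ((Ω →₀ K) ⊗[K] A) :=
  TensorProduct.lift (Finsupp.linearCombination K fun α =>
    (TensorProduct.uncurry (.id K) (Ω →₀ K) A ((Ω →₀ K) ⊗[K] A)).comp
      (LinearMap.flip (Finsupp.linearCombination K fun β =>
        (p (tp α β)).compr₂ (TensorProduct.mk K (Ω →₀ K) A (Finsupp.single (op α β) 1)))))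

theorem typedTensorProduct_tmul {K : Type*} [Field K] {Ω : Type*} {A : Type*} [AddCommGroup A]
    [Module K A] (op tp : Ω → Ω → Ω) (p : Ω → A →ₗ[K] A →ₗ[K] A) (α β : Ω) (x y : A) :
    typedTensorProduct op tp p (Finsupp.single α 1 ⊗ₜ[K] x) (Finsupp.single β 1 ⊗ₜ[K] y)
      = Finsupp.single (op α β) 1 ⊗ₜ[K] p (tp α β) x y := by
  simp [typedTensorProduct]

/-- The vector space `KΩ ⊗ K𝒯⁺_Ω`. -/
abbrev TreeSpace (K Ω : Type*) [Field K] : Type _ := (Ω →₀ K) ⊗[K] (TypedTree Ω →₀ K)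

/-- The product `≺` on `KΩ ⊗ K𝒯⁺_Ω`: `(α ⊗ x) ≺ (β ⊗ y) = (α ← β) ⊗ (x ≺_{α ◁ β} y)`. -/
def treePrec (K Ω : Type*) [Field K] [FourProducts Ω] :
    TreeSpace K Ω →ₗ[K] TreeSpace K Ω →ₗ[K] TreeSpace K Ω :=
  typedTensorProduct (fun α β => α ↼ β) (fun α β => α ◁ₑ β) (TypedTree.precLin K)

/-- The product `≻` on `KΩ ⊗ K𝒯⁺_Ω`: `(α ⊗ x) ≻ (β ⊗ y) = (α → β) ⊗ (x ≻_{α ▷ β} y)`. -/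
def treeSucc (K Ω : Type*) [Field K] [FourProducts Ω] :
    TreeSpace K Ω →ₗ[K] TreeSpace K Ω →ₗ[K] TreeSpace K Ω :=
  typedTensorProduct (fun α β => α ⇀ β) (fun α β => α ▷ₑ β) (TypedTree.succLin K)

/-- The basis element `α ⊗ T` of `KΩ ⊗ K𝒯⁺_Ω`. -/
def treeBasis (K : Type*) {Ω : Type*} [Field K] (α : Ω) (T : TypedTree Ω) : TreeSpace K Ω :=
  Finsupp.single α 1 ⊗ₜ[K] Finsupp.single T 1

/-- The subspace `KΩ ⊗ K𝒯_Ω(n)` of `KΩ ⊗ K𝒯⁺_Ω`, spanned by the `α ⊗ T` where `T` has `n` internal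
vertices. -/
def treeDegree (K Ω : Type*) [Field K] (n : ℕ) : Submodule K (TreeSpace K Ω) :=
  Submodule.span K {a | ∃ (α : Ω) (T : TypedTree Ω), T.numVertices = n ∧ a = treeBasis K α T}

/-- `(A, ≺, ≻)` is a dendriform algebra, where `p` is `≺` and `s` is `≻`. -/
structure IsDendriform {K A : Type*} [Field K] [AddCommGroup A] [Module K A]
    (p s : A →ₗ[K] A →ₗ[K] A) : Prop where
  prec_prec : ∀ x y z, p (p x y) z = p x (p y z + s y z)
  succ_prec : ∀ x y z, p (s x y) z = s x (p y z)
  succ_succ : ∀ x y z, s (p x y + s x y) z = s x (s y z)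

/-- `(A, ≺, ≻, Δ)` is a dendriform bialgebra, where `p` is `≺`, `s` is `≻` and `p + s` is the
associative product. With `Δ a = a' ⊗ a''`, the last two axioms read
`Δ(x≺y) = x⊗y + x'≺y⊗x'' + x'⊗x''·y + x≺y'⊗y'' + x'≺y'⊗x''·y''` and
`Δ(x≻y) = y⊗x + x'≻y⊗x'' + y'⊗x·y'' + x≻y'⊗y'' + x'≻y'⊗x''·y''`. -/
structure IsDendriformBialgebra {K A : Type*} [Field K] [AddCommGroup A] [Module K A]
    (p s : A →ₗ[K] A →ₗ[K] A) (Δ : A →ₗ[K] A ⊗[K] A) : Prop where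
  dendriform : IsDendriform p s
  coassoc : ∀ x, TensorProduct.assoc K A A A (Δ.rTensor A (Δ x)) = Δ.lTensor A (Δ x)
  comul_prec : ∀ x y, Δ (p x y) =
    x ⊗ₜ[K] y
      + (p.flip y).rTensor A (Δ x)
      + ((p + s).flip y).lTensor A (Δ x)
      + (p x).rTensor A (Δ y)
      + TensorProduct.map₂ p (p + s) (Δ x) (Δ y)
  comul_succ : ∀ x y, Δ (s x y) =
    y ⊗ₜ[K] x
      + (s.flip y).rTensor A (Δ x)
      + ((p + s) x).lTensor A (Δ y)
      + (s x).rTensor A (Δ y)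
      + TensorProduct.map₂ s (p + s) (Δ x) (Δ y)

/-- The operations `≺`, `≻`, `Δ` on `A` are homogeneous for the grading `A = ⨁ₙ 𝒜 n`; in particular
`Δ (𝒜 n) ⊆ ∑_{i+j=n} 𝒜 i ⊗ 𝒜 j`. -/
structure IsDendriformGrading {K A : Type*} [Field K] [AddCommGroup A] [Module K A]
    (p s : A →ₗ[K] A →ₗ[K] A) (Δ : A →ₗ[K] A ⊗[K] A) (𝒜 : ℕ → Submodule K A) : Prop where
  isInternal : DirectSum.IsInternal 𝒜
  prec_mem : ∀ m n x y, x ∈ 𝒜 m → y ∈ 𝒜 n → p x y ∈ 𝒜 (m + n)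
  succ_mem : ∀ m n x y, x ∈ 𝒜 m → y ∈ 𝒜 n → s x y ∈ 𝒜 (m + n)
  comul_mem : ∀ n x, x ∈ 𝒜 n → Δ x ∈ ⨆ (i : ℕ) (j : ℕ) (_ : i + j = n),
    Submodule.map₂ (TensorProduct.mk K A A) (𝒜 i) (𝒜 j)

end

/-!
Nondegeneracy identifies `KΩ ⊗ K𝒯⁺_Ω` with the free dendriform algebra on `Ω`, that is, the space of
nonempty plane binary trees whose vertices are decorated by `Ω`; on the latter, the coproduct of
Loday and Ronco is the one required.

The identification is `TypedTree.encode`. Since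
`(δ ⊗ x) ≻ (ω ⊗ Y) = (δ → ω) ⊗ (x ⋁_{δ ▷ ω, ∅} |)`, and similarly for `≺`, bijectivity of `φ_←` and
`φ_→` makes each `α ⊗ T` equal, in a unique way, to some `x ≻ (ω ⊗ Y) ≺ y`, where `x` and `y` are
basis elements or empty. Iterating, `α ⊗ T` becomes a tree with decorated vertices. The axioms of
an extended diassociative semigroup turn the defining recursions of the typed products into
`(l ∨ r) ≺ z = l ∨ (r · z)` and `z ≻ (l ∨ r) = (z · l) ∨ r` (`TreeSpace.toDecorated_products`).

On decorated trees it is convenient to keep the empty tree, as a unit. Associativity of the product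
is an induction on the number of vertices, and the dendriform axioms follow from it. The counital
coproduct is defined by `Δ̄(l ∨ r) = 1 ⊗ (l ∨ r) + (l' ∨ r') ⊗ l'' · r''`; it is multiplicative
(`DecoratedTree.comul_mul`), which gives coassociativity, and
`Δ̄(x ≺ y) = 1 ⊗ (x ≺ y) + x' ≺ y' ⊗ x'' · y''` with its analogue for `≻`. The projection that kills
the empty tree carries `Δ̄` to a coassociative coproduct `Δ` with `Δ̄ x = x ⊗ 1 + 1 ⊗ x + Δ x`, and
substituting this into the last formulas gives the axioms of a dendriform bialgebra.

The elements `α ⊗ Y` generate (`TreeSpace.treeBasis_induction`), and the axioms determine `Δ` on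
products from its values on the factors; hence uniqueness, and homogeneity by the same induction.
-/

/-! ### The free dendriform algebra on plane binary trees with decorated vertices -/

noncomputable section

namespace DecoratedTree

open BinaryTree Finsupp

variable (K : Type*) [Field K] {Ω : Type*}

/-- The product of two plane binary trees with vertices decorated by `Ω`, a linear combination of
such trees. The empty tree is the unit. -/
def treeMul : BinaryTree Ω → BinaryTree Ω → (BinaryTree Ω →₀ K)
  | nil, t => single t 1
  | node a l r, nil => single (node a l r) 1
  | node a l r, node b l' r' =>
      mapDomain (fun u => node a l u) (treeMul r (node b l' r'))
        + mapDomain (fun u => node b u r') (treeMul (node a l r) l')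
termination_by s t => s.numNodes + t.numNodes
decreasing_by all_goals (simp only [numNodes]; omega)

/-- The bilinear extension of `treeMul`. -/
def mul : (BinaryTree Ω →₀ K) →ₗ[K] (BinaryTree Ω →₀ K) →ₗ[K] (BinaryTree Ω →₀ K) :=
  linearCombination K fun s => linearCombination K fun t => treeMul K s t

/-- The bilinear grafting operator: `graft K a l r` is the tree with root decorated by `a` and with
left and right subtrees `l` and `r`. -/
def graft (a : Ω) :
    (BinaryTree Ω →₀ K) →ₗ[K] (BinaryTree Ω →₀ K) →ₗ[K] (BinaryTree Ω →₀ K) :=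
  linearCombination K fun l => linearCombination K fun r => single (node a l r) 1

/-- The product `≺`, extended to the empty tree by `nil ≺ y = 0` and `x ≺ nil = x` for `x ≠ nil`. -/
def prec : (BinaryTree Ω →₀ K) →ₗ[K] (BinaryTree Ω →₀ K) →ₗ[K] (BinaryTree Ω →₀ K) :=
  linearCombination K fun s => match s with
    | nil => 0
    | node a l r => (graft K a (single l 1)).comp (mul K (single r 1))

/-- The product `≻`, extended to the empty tree by `x ≻ nil = 0` and `nil ≻ y = y` for `y ≠ nil`. -/
def succ : (BinaryTree Ω →₀ K) →ₗ[K] (BinaryTree Ω →₀ K) →ₗ[K] (BinaryTree Ω →₀ K) :=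
  LinearMap.flip (linearCombination K fun t => match t with
    | nil => 0
    | node a l r => ((graft K a).flip (single r 1)).comp ((mul K).flip (single l 1)))

/-- The coefficient of the empty tree. -/
def counit : (BinaryTree Ω →₀ K) →ₗ[K] K := lapply nil

variable {K} in
/-- A property stable under linear combinations holds everywhere once it holds on trees. -/
@[elab_as_elim]
theorem tree_induction {C : (BinaryTree Ω →₀ K) → Prop} (x : BinaryTree Ω →₀ K)
    (add : ∀ x y, C x → C y → C (x + y)) (smul : ∀ (c : K) x, C x → C (c • x))
    (tree : ∀ t, C (single t 1)) : C x := by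
  induction x using Finsupp.induction_linear with
  | zero => simpa using smul 0 _ (tree nil)
  | add f g hf hg => exact add f g hf hg
  | single t c => simpa using smul c _ (tree t)

@[simp] theorem graft_single (a : Ω) (l r : BinaryTree Ω) :
    graft K a (single l 1) (single r 1) = single (node a l r) 1 := by
  simp [graft]

theorem graft_single_left (a : Ω) (l : BinaryTree Ω) (v : BinaryTree Ω →₀ K) :
    graft K a (single l 1) v = mapDomain (fun u => node a l u) v := by
  induction v using Finsupp.induction_linear with
  | zero => simp
  | add f g hf hg => simp [hf, hg, mapDomain_add]
  | single t c => simp [graft]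

theorem graft_single_right (a : Ω) (u : BinaryTree Ω →₀ K) (r : BinaryTree Ω) :
    graft K a u (single r 1) = mapDomain (fun l => node a l r) u := by
  induction u using Finsupp.induction_linear with
  | zero => simp
  | add f g hf hg => simp [hf, hg, mapDomain_add]
  | single t c => simp [graft]

theorem mul_single_nil_left (v : BinaryTree Ω →₀ K) : mul K (single nil 1) v = v := by
  induction v using Finsupp.induction_linear with
  | zero => simp
  | add f g hf hg => simp [hf, hg]
  | single t c => simp [mul, treeMul]

theorem mul_single_nil_right (v : BinaryTree Ω →₀ K) : mul K v (single nil 1) = v := by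
  induction v using Finsupp.induction_linear with
  | zero => simp
  | add f g hf hg => simp [hf, hg]
  | single t c => cases t <;> simp [mul, treeMul]

@[simp] theorem prec_nil_left (v : BinaryTree Ω →₀ K) : prec K (single nil 1) v = 0 := by
  simp [prec]

@[simp] theorem succ_nil_right (v : BinaryTree Ω →₀ K) : succ K v (single nil 1) = 0 := by
  simp [succ]

@[simp] theorem counit_nil : counit K (single (nil : BinaryTree Ω) 1) = 1 := by
  simp [counit]

@[simp] theorem counit_node (a : Ω) (l r : BinaryTree Ω) :
    counit K (single (node a l r) 1) = 0 := by
  simp [counit]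

@[simp] theorem counit_graft (a : Ω) (u v : BinaryTree Ω →₀ K) :
    counit K (graft K a u v) = 0 := by
  refine tree_induction u (fun _ _ h h' => by simp [h, h']) (fun _ _ h => by simp [h]) fun l => ?_
  refine tree_induction v (fun _ _ h h' => by simp [h, h']) (fun _ _ h => by simp [h]) fun r => ?_
  simp

/-- `(l ∨ r) ≺ w = l ∨ (r · w)`. -/
theorem prec_graft (a : Ω) (u v w : BinaryTree Ω →₀ K) :
    prec K (graft K a u v) w = graft K a u (mul K v w) := by
  refine tree_induction u (fun _ _ h h' => by simp [h, h']) (fun _ _ h => by simp [h]) fun l => ?_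
  refine tree_induction v (fun _ _ h h' => by simp [h, h']) (fun _ _ h => by simp [h]) fun r => ?_
  simp [prec]

/-- `w ≻ (l ∨ r) = (w · l) ∨ r`. -/
theorem succ_graft (a : Ω) (w u v : BinaryTree Ω →₀ K) :
    succ K w (graft K a u v) = graft K a (mul K w u) v := by
  refine tree_induction u (fun _ _ h h' => by simp [h, h']) (fun _ _ h => by simp [h]) fun l => ?_
  refine tree_induction v (fun _ _ h h' => by simp [h, h']) (fun _ _ h => by simp [h]) fun r => ?_
  simp [succ]

theorem mul_eq_of_basis (s t : BinaryTree Ω) :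
    mul K (single s 1) (single t 1) = prec K (single s 1) (single t 1)
      + succ K (single s 1) (single t 1)
      + (counit K (single s 1) * counit K (single t 1)) • single nil 1 := by
  cases s with
  | nil =>
    cases t with
    | nil => simp [mul_single_nil_left]
    | node b l' r' =>
      rw [← graft_single, succ_graft]
      simp [mul_single_nil_left]
  | node a l r =>
    cases t with
    | nil =>
      rw [← graft_single, prec_graft]
      simp [mul_single_nil_right]
    | node b l' r' =>
      have h : mul K (single (node a l r) 1) (single (node b l' r') 1)
          = mapDomain (fun u => node a l u) (mul K (single r 1) (single (node b l' r') 1))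
            + mapDomain (fun u => node b u r') (mul K (single (node a l r) 1) (single l' 1)) := by
        simp [mul, treeMul]
      rw [h, ← graft_single_left, ← graft_single_right, ← prec_graft, ← succ_graft]
      simp only [graft_single]
      rw [← graft_single, counit_graft]
      simp

/-- The associative product is `≺ + ≻`, except on the unit component. -/
theorem mul_eq (x y : BinaryTree Ω →₀ K) :
    mul K x y = prec K x y + succ K x y + (counit K x * counit K y) • single nil 1 := by
  refine tree_induction x (fun _ _ h h' => ?_) (fun c _ h => ?_) fun s => ?_
  · simp only [map_add, LinearMap.add_apply, h, h', add_mul, add_smul]; abel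
  · simp only [map_smul, LinearMap.smul_apply, h, smul_eq_mul, mul_assoc, smul_add, mul_smul]
  refine tree_induction y (fun _ _ h h' => ?_) (fun c _ h => ?_) fun t => ?_
  · simp only [map_add, h, h', mul_add, add_smul]; abel
  · simp only [map_smul, h, smul_eq_mul, mul_left_comm _ c, smul_add, mul_smul]
  exact mul_eq_of_basis K s t

theorem counit_prec (x y : BinaryTree Ω →₀ K) : counit K (prec K x y) = 0 := by
  refine tree_induction x (fun _ _ h h' => by simp [h, h']) (fun _ _ h => by simp [h]) fun s => ?_
  cases s with
  | nil => simp
  | node a l r => rw [← graft_single, prec_graft, counit_graft]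

theorem counit_succ (x y : BinaryTree Ω →₀ K) : counit K (succ K x y) = 0 := by
  refine tree_induction y (fun _ _ h h' => by simp [h, h']) (fun _ _ h => by simp [h]) fun s => ?_
  cases s with
  | nil => simp
  | node a l r => rw [← graft_single, succ_graft, counit_graft]

theorem counit_mul (x y : BinaryTree Ω →₀ K) :
    counit K (mul K x y) = counit K x * counit K y := by
  rw [mul_eq, map_add, map_add, counit_prec, counit_succ, map_smul, counit_nil]
  simp

theorem mul_assoc_of_basis (s t u : BinaryTree Ω) :
    mul K (mul K (single s 1) (single t 1)) (single u 1)
      = mul K (single s 1) (mul K (single t 1) (single u 1)) := by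
  induction hn : s.numNodes + t.numNodes + u.numNodes using Nat.strong_induction_on
    generalizing s t u with
  | _ n ih =>
    subst hn
    rcases s with _ | ⟨a, l, r⟩
    · simp [mul_single_nil_left]
    rcases t with _ | ⟨b, l', r'⟩
    · simp [mul_single_nil_left, mul_single_nil_right]
    rcases u with _ | ⟨c, l'', r''⟩
    · simp [mul_single_nil_right]
    have h1 := ih _ (by simp only [numNodes]; omega) r (node b l' r') (node c l'' r'') rfl
    have h2 := ih _ (by simp only [numNodes]; omega) (node a l r) (node b l' r') l'' rfl
    have hx : counit K (single (node a l r) 1) = 0 := by rw [← graft_single, counit_graft]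
    have hz : counit K (single (node c l'' r'') 1) = 0 := by rw [← graft_single, counit_graft]
    -- The three dendriform axioms for these trees; the first and the last need associativity for
    -- smaller trees, and their sum is the claim.
    have e1 : prec K (prec K (single (node a l r) 1) (single (node b l' r') 1))
          (single (node c l'' r'') 1)
        = prec K (single (node a l r) 1)
            (mul K (single (node b l' r') 1) (single (node c l'' r'') 1)) := by
      rw [← graft_single K a, prec_graft, prec_graft, prec_graft, h1]
    have e2 : prec K (succ K (single (node a l r) 1) (single (node b l' r') 1))
          (single (node c l'' r'') 1)
        = succ K (single (node a l r) 1)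
            (prec K (single (node b l' r') 1) (single (node c l'' r'') 1)) := by
      rw [← graft_single K b, succ_graft, prec_graft, prec_graft, succ_graft]
    have e3 : succ K (mul K (single (node a l r) 1) (single (node b l' r') 1))
          (single (node c l'' r'') 1)
        = succ K (single (node a l r) 1)
            (succ K (single (node b l' r') 1) (single (node c l'' r'') 1)) := by
      rw [← graft_single K c, succ_graft, succ_graft, succ_graft, h2]
    rw [mul_eq K (mul K _ _), e3, mul_eq K (single (node a l r) 1) (mul K _ _), ← e1, hx, hz,
      mul_eq K (single (node a l r) 1) (single (node b l' r') 1),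
      mul_eq K (single (node b l' r') 1) (single (node c l'' r'') 1), hx, hz]
    simp only [map_add, LinearMap.add_apply, e2, mul_zero, zero_mul, zero_smul, add_zero]
    abel

/-- The product of decorated trees is associative. -/
theorem mul_assoc' (x y z : BinaryTree Ω →₀ K) :
    mul K (mul K x y) z = mul K x (mul K y z) := by
  refine tree_induction x (fun _ _ h h' => by simp [h, h']) (fun _ _ h => by simp [h]) fun s => ?_
  refine tree_induction y (fun _ _ h h' => by simp [h, h']) (fun _ _ h => by simp [h]) fun t => ?_
  refine tree_induction z (fun _ _ h h' => by simp [h, h']) (fun _ _ h => by simp [h]) fun u => ?_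
  exact mul_assoc_of_basis K s t u

theorem prec_prec (x y z : BinaryTree Ω →₀ K) :
    prec K (prec K x y) z = prec K x (mul K y z) := by
  refine tree_induction x (fun _ _ h h' => by simp [h, h']) (fun _ _ h => by simp [h]) fun s => ?_
  cases s with
  | nil => simp
  | node a l r => rw [← graft_single, prec_graft, prec_graft, prec_graft, mul_assoc']

theorem succ_prec (x y z : BinaryTree Ω →₀ K) :
    prec K (succ K x y) z = succ K x (prec K y z) := by
  refine tree_induction y (fun _ _ h h' => by simp [h, h']) (fun _ _ h => by simp [h]) fun s => ?_
  cases s with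
  | nil => simp
  | node a l r => rw [← graft_single, succ_graft, prec_graft, prec_graft, succ_graft]

theorem succ_succ (x y z : BinaryTree Ω →₀ K) :
    succ K (mul K x y) z = succ K x (succ K y z) := by
  refine tree_induction z (fun _ _ h h' => by simp [h, h']) (fun _ _ h => by simp [h]) fun s => ?_
  cases s with
  | nil => simp
  | node a l r => rw [← graft_single, succ_graft, succ_graft, succ_graft, mul_assoc']

end DecoratedTree

end

/-! ### The counital coproduct -/

noncomputable section

namespace DecoratedTree

open BinaryTree Finsupp TensorProduct

variable (K : Type*) [Field K] {Ω : Type*}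

/-- The counital coproduct on trees: the empty tree is group-like, and
`Δ̄(l ∨ r) = nil ⊗ (l ∨ r) + (l' ∨ r') ⊗ l'' · r''`. -/
def treeComul : BinaryTree Ω → (BinaryTree Ω →₀ K) ⊗[K] (BinaryTree Ω →₀ K)
  | nil => single nil 1 ⊗ₜ single nil 1
  | node a l r => single nil 1 ⊗ₜ single (node a l r) 1
      + map₂ (graft K a) (mul K) (treeComul l) (treeComul r)

/-- The linear extension of `treeComul`. -/
def comul : (BinaryTree Ω →₀ K) →ₗ[K] (BinaryTree Ω →₀ K) ⊗[K] (BinaryTree Ω →₀ K) :=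
  linearCombination K (treeComul K)

@[simp] theorem comul_nil :
    comul K (single (nil : BinaryTree Ω) 1) = single nil 1 ⊗ₜ single nil 1 := by
  simp [comul, treeComul]

theorem comul_graft (a : Ω) (u v : BinaryTree Ω →₀ K) :
    comul K (graft K a u v) = single nil 1 ⊗ₜ graft K a u v
      + map₂ (graft K a) (mul K) (comul K u) (comul K v) := by
  refine tree_induction u (fun _ _ h h' => ?_) (fun _ _ h => ?_) fun l => ?_
  · simp only [map_add, LinearMap.add_apply, h, h', tmul_add]; abel
  · simp only [map_smul, LinearMap.smul_apply, h, tmul_smul, smul_add]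
  refine tree_induction v (fun _ _ h h' => ?_) (fun _ _ h => ?_) fun r => ?_
  · simp only [map_add, h, h', tmul_add]; abel
  · simp only [map_smul, h, tmul_smul, smul_add]
  simp [comul, treeComul]

theorem rTensor_counit_comul (x : BinaryTree Ω →₀ K) :
    (counit K).rTensor _ (comul K x) = 1 ⊗ₜ x := by
  refine tree_induction x (fun _ _ h h' => by simp [h, h', tmul_add]) (fun _ _ h => by simp [h])
    fun s => ?_
  cases s with
  | nil => simp
  | node a l r =>
    have h : ∀ X Y : (BinaryTree Ω →₀ K) ⊗[K] (BinaryTree Ω →₀ K),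
        (counit K).rTensor _ (map₂ (graft K a) (mul K) X Y) = 0 := by
      intro X Y
      induction X using TensorProduct.induction_on with
      | zero => simp
      | add X X' h h' => simp [h, h']
      | tmul p q =>
        induction Y using TensorProduct.induction_on with
        | zero => simp
        | add Y Y' h h' => rw [map_add, map_add, h, h', add_zero]
        | tmul p' q' => simp
    rw [← graft_single, comul_graft, map_add, h]
    simp

theorem lTensor_counit_comul_of_basis (s : BinaryTree Ω) :
    (counit K).lTensor _ (comul K (single s 1)) = single s 1 ⊗ₜ 1 := by
  induction s with
  | nil => simp
  | node a l r ihl ihr =>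
    have h : ∀ X Y : (BinaryTree Ω →₀ K) ⊗[K] (BinaryTree Ω →₀ K),
        (counit K).lTensor _ (map₂ (graft K a) (mul K) X Y)
          = map₂ (graft K a) (LinearMap.mul K K) ((counit K).lTensor _ X)
              ((counit K).lTensor _ Y) := by
      intro X Y
      induction X using TensorProduct.induction_on with
      | zero => simp
      | add X X' h h' => simp [h, h']
      | tmul p q =>
        induction Y using TensorProduct.induction_on with
        | zero => simp
        | add Y Y' h h' => simp only [map_add, h, h']
        | tmul p' q' => simp [counit_mul]
    rw [← graft_single, comul_graft, map_add, h, ihl, ihr]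
    simp

theorem lTensor_counit_comul (x : BinaryTree Ω →₀ K) :
    (counit K).lTensor _ (comul K x) = x ⊗ₜ 1 := by
  refine tree_induction x (fun _ _ h h' => by simp [h, h', add_tmul])
    (fun _ _ h => by simp [h, smul_tmul']) fun s => ?_
  exact lTensor_counit_comul_of_basis K s

/-- The product of the tensor square splits into its `≺` and `≻` parts, up to a correction on the
components with a unit in both left factors. -/
theorem map₂_mul_mul (X Y : (BinaryTree Ω →₀ K) ⊗[K] (BinaryTree Ω →₀ K)) :
    map₂ (mul K) (mul K) X Y = map₂ (prec K) (mul K) X Y + map₂ (succ K) (mul K) X Y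
      + single nil 1 ⊗ₜ mul K (TensorProduct.lid K _ ((counit K).rTensor _ X))
          (TensorProduct.lid K _ ((counit K).rTensor _ Y)) := by
  induction X using TensorProduct.induction_on with
  | zero => simp
  | add X X' h h' => simp only [map_add, LinearMap.add_apply, h, h', tmul_add]; abel
  | tmul p q =>
    induction Y using TensorProduct.induction_on with
    | zero => simp
    | add Y Y' h h' => simp only [map_add, h, h', tmul_add]; abel
    | tmul p' q' =>
      simp only [map₂_apply_tmul, map_tmul, LinearMap.rTensor_tmul, lid_tmul, map_smul,
        LinearMap.smul_apply, mul_eq K p p', add_tmul, smul_tmul, tmul_smul, mul_smul]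
      rw [smul_comm]

theorem map₂_prec_map₂_graft (a : Ω) (X Y Z : (BinaryTree Ω →₀ K) ⊗[K] (BinaryTree Ω →₀ K)) :
    map₂ (prec K) (mul K) (map₂ (graft K a) (mul K) X Y) Z
      = map₂ (graft K a) (mul K) X (map₂ (mul K) (mul K) Y Z) := by
  induction X using TensorProduct.induction_on with
  | zero => simp
  | add X X' h h' => simp only [map_add, LinearMap.add_apply, h, h']
  | tmul p q =>
    induction Y using TensorProduct.induction_on with
    | zero => simp
    | add Y Y' h h' => simp only [map_add, LinearMap.add_apply, h, h']
    | tmul p' q' =>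
      induction Z using TensorProduct.induction_on with
      | zero => simp
      | add Z Z' h h' => simp only [map_add, h, h']
      | tmul p'' q'' => simp [prec_graft, mul_assoc']

theorem map₂_succ_map₂_graft (a : Ω) (X Y Z : (BinaryTree Ω →₀ K) ⊗[K] (BinaryTree Ω →₀ K)) :
    map₂ (succ K) (mul K) X (map₂ (graft K a) (mul K) Y Z)
      = map₂ (graft K a) (mul K) (map₂ (mul K) (mul K) X Y) Z := by
  induction X using TensorProduct.induction_on with
  | zero => simp
  | add X X' h h' => simp only [map_add, LinearMap.add_apply, h, h']
  | tmul p q =>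
    induction Y using TensorProduct.induction_on with
    | zero => simp
    | add Y Y' h h' => simp only [map_add, LinearMap.add_apply, h, h']
    | tmul p' q' =>
      induction Z using TensorProduct.induction_on with
      | zero => simp
      | add Z Z' h h' => simp only [map_add, h, h']
      | tmul p'' q'' => simp [succ_graft, mul_assoc']

theorem map₂_mul_mul_nil_left (Y : (BinaryTree Ω →₀ K) ⊗[K] (BinaryTree Ω →₀ K)) :
    map₂ (mul K) (mul K) (single nil 1 ⊗ₜ single nil 1) Y = Y := by
  induction Y using TensorProduct.induction_on with
  | zero => simp
  | add Y Y' h h' => simp only [map_add, h, h']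
  | tmul p' q' => simp [mul_single_nil_left]

theorem map₂_mul_mul_nil_right (Y : (BinaryTree Ω →₀ K) ⊗[K] (BinaryTree Ω →₀ K)) :
    map₂ (mul K) (mul K) Y (single nil 1 ⊗ₜ single nil 1) = Y := by
  induction Y using TensorProduct.induction_on with
  | zero => simp
  | add Y Y' h h' => simp only [map_add, LinearMap.add_apply, h, h']
  | tmul p' q' => simp [mul_single_nil_right]

theorem map₂_succ_mul_nil_right (X : (BinaryTree Ω →₀ K) ⊗[K] (BinaryTree Ω →₀ K))
    (y : BinaryTree Ω →₀ K) :
    map₂ (succ K) (mul K) X (single nil 1 ⊗ₜ y) = 0 := by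
  induction X using TensorProduct.induction_on with
  | zero => simp
  | add Y Y' h h' => simp only [map_add, LinearMap.add_apply, h, h', add_zero]
  | tmul p' q' => simp

theorem map₂_prec_mul_nil_left (y : BinaryTree Ω →₀ K)
    (Y : (BinaryTree Ω →₀ K) ⊗[K] (BinaryTree Ω →₀ K)) :
    map₂ (prec K) (mul K) (single nil 1 ⊗ₜ y) Y = 0 := by
  induction Y using TensorProduct.induction_on with
  | zero => simp
  | add Y Y' h h' => simp only [map_add, h, h', add_zero]
  | tmul p' q' => simp

theorem comul_prec_graft (a : Ω) (u v w : BinaryTree Ω →₀ K)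
    (h : comul K (mul K v w) = map₂ (mul K) (mul K) (comul K v) (comul K w)) :
    comul K (prec K (graft K a u v) w) = single nil 1 ⊗ₜ prec K (graft K a u v) w
      + map₂ (prec K) (mul K) (comul K (graft K a u v)) (comul K w) := by
  rw [prec_graft, comul_graft, comul_graft, map_add, LinearMap.add_apply, map₂_prec_mul_nil_left,
    map₂_prec_map₂_graft, h, zero_add]

theorem comul_succ_graft (a : Ω) (u v w : BinaryTree Ω →₀ K)
    (h : comul K (mul K w u) = map₂ (mul K) (mul K) (comul K w) (comul K u)) :
    comul K (succ K w (graft K a u v)) = single nil 1 ⊗ₜ succ K w (graft K a u v)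
      + map₂ (succ K) (mul K) (comul K w) (comul K (graft K a u v)) := by
  rw [succ_graft, comul_graft, comul_graft, map_add, map₂_succ_mul_nil_right,
    map₂_succ_map₂_graft, h, zero_add]

theorem comul_mul_of_basis (s t : BinaryTree Ω) :
    comul K (mul K (single s 1) (single t 1))
      = map₂ (mul K) (mul K) (comul K (single s 1)) (comul K (single t 1)) := by
  induction hn : s.numNodes + t.numNodes using Nat.strong_induction_on generalizing s t with
  | _ n ih =>
    subst hn
    rcases s with _ | ⟨a, l, r⟩
    · rw [mul_single_nil_left, comul_nil, map₂_mul_mul_nil_left]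
    rcases t with _ | ⟨b, l', r'⟩
    · rw [mul_single_nil_right, comul_nil, map₂_mul_mul_nil_right]
    have h1 := ih _ (by simp only [numNodes]; omega) r (node b l' r') rfl
    have h2 := ih _ (by simp only [numNodes]; omega) (node a l r) l' rfl
    have e1 := comul_prec_graft K a (single l 1) _ _ h1
    have e2 := comul_succ_graft K b _ (single r' 1) _ h2
    rw [graft_single] at e1 e2
    rw [map₂_mul_mul, rTensor_counit_comul, rTensor_counit_comul, lid_tmul, lid_tmul, one_smul,
      one_smul, mul_eq, counit_node, zero_mul, zero_smul, add_zero, map_add, e1, e2, tmul_add]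
    abel

/-- The coproduct is multiplicative. -/
theorem comul_mul (x y : BinaryTree Ω →₀ K) :
    comul K (mul K x y) = map₂ (mul K) (mul K) (comul K x) (comul K y) := by
  refine tree_induction x (fun _ _ h h' => by simp [h, h']) (fun _ _ h => by simp [h]) fun s => ?_
  refine tree_induction y (fun _ _ h h' => by simp [h, h']) (fun _ _ h => by simp [h]) fun t => ?_
  exact comul_mul_of_basis K s t

theorem comul_prec (x y : BinaryTree Ω →₀ K) :
    comul K (prec K x y) = single nil 1 ⊗ₜ prec K x y
      + map₂ (prec K) (mul K) (comul K x) (comul K y) := by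
  refine tree_induction x (fun _ _ h h' => ?_) (fun _ _ h => ?_) fun s => ?_
  · simp only [map_add, LinearMap.add_apply, h, h', tmul_add]; abel
  · simp only [map_smul, LinearMap.smul_apply, h, tmul_smul, smul_add]
  cases s with
  | nil => rw [comul_nil, map₂_prec_mul_nil_left, prec_nil_left, map_zero, tmul_zero, add_zero]
  | node a l r =>
    have h := comul_prec_graft K a (single l 1) (single r 1) y (comul_mul K _ _)
    rwa [graft_single] at h

theorem comul_succ (x y : BinaryTree Ω →₀ K) :
    comul K (succ K x y) = single nil 1 ⊗ₜ succ K x y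
      + map₂ (succ K) (mul K) (comul K x) (comul K y) := by
  refine tree_induction y (fun _ _ h h' => ?_) (fun _ _ h => ?_) fun s => ?_
  · simp only [map_add, h, h', tmul_add]; abel
  · simp only [map_smul, h, tmul_smul, smul_add]
  cases s with
  | nil => rw [comul_nil, map₂_succ_mul_nil_right, succ_nil_right, map_zero, tmul_zero, add_zero]
  | node a l r =>
    have h := comul_succ_graft K a (single l 1) (single r 1) x (comul_mul K _ _)
    rwa [graft_single] at h

/-- Three-fold tensors multiply componentwise, whichever way they are bracketed. -/
theorem assoc_map₂_tmul (a : Ω) (q q' : BinaryTree Ω →₀ K)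
    (P P' : (BinaryTree Ω →₀ K) ⊗[K] (BinaryTree Ω →₀ K)) :
    TensorProduct.assoc K _ _ _ (map₂ (graft K a) (mul K) P P' ⊗ₜ mul K q q')
      = map₂ (graft K a) (map₂ (mul K) (mul K)) (TensorProduct.assoc K _ _ _ (P ⊗ₜ q))
          (TensorProduct.assoc K _ _ _ (P' ⊗ₜ q')) := by
  induction P using TensorProduct.induction_on with
  | zero => simp
  | add X X' h h' => simp only [map_add, LinearMap.add_apply, add_tmul, h, h']
  | tmul p r =>
    induction P' using TensorProduct.induction_on with
    | zero => simp
    | add Y Y' h h' => simp only [map_add, add_tmul, h, h']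
    | tmul p' r' => simp

theorem assoc_rTensor_comul_map₂ (a : Ω)
    (X Y : (BinaryTree Ω →₀ K) ⊗[K] (BinaryTree Ω →₀ K)) :
    TensorProduct.assoc K _ _ _ ((comul K).rTensor _ (map₂ (graft K a) (mul K) X Y))
      = single nil 1 ⊗ₜ map₂ (graft K a) (mul K) X Y
        + map₂ (graft K a) (map₂ (mul K) (mul K))
            (TensorProduct.assoc K _ _ _ ((comul K).rTensor _ X))
            (TensorProduct.assoc K _ _ _ ((comul K).rTensor _ Y)) := by
  induction X using TensorProduct.induction_on with
  | zero => simp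
  | add X X' h h' => simp only [map_add, LinearMap.add_apply, tmul_add, h, h']; abel
  | tmul p q =>
    induction Y using TensorProduct.induction_on with
    | zero => simp
    | add Y Y' h h' => simp only [map_add, tmul_add, h, h']; abel
    | tmul p' q' =>
      simp only [map₂_apply_tmul, map_tmul, LinearMap.rTensor_tmul, comul_graft, add_tmul, map_add,
        assoc_tmul, ← assoc_map₂_tmul]

theorem lTensor_comul_map₂ (a : Ω) (X Y : (BinaryTree Ω →₀ K) ⊗[K] (BinaryTree Ω →₀ K)) :
    (comul K).lTensor _ (map₂ (graft K a) (mul K) X Y)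
      = map₂ (graft K a) (map₂ (mul K) (mul K)) ((comul K).lTensor _ X)
          ((comul K).lTensor _ Y) := by
  induction X using TensorProduct.induction_on with
  | zero => simp
  | add X X' h h' => simp only [map_add, LinearMap.add_apply, h, h']
  | tmul p q =>
    induction Y using TensorProduct.induction_on with
    | zero => simp
    | add Y Y' h h' => simp only [map_add, h, h']
    | tmul p' q' =>
      simp only [map₂_apply_tmul, map_tmul, LinearMap.lTensor_tmul, comul_mul]

theorem comul_coassoc_of_basis (s : BinaryTree Ω) :
    TensorProduct.assoc K _ _ _ ((comul K).rTensor _ (comul K (single s 1)))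
      = (comul K).lTensor _ (comul K (single s 1)) := by
  induction s with
  | nil => simp
  | node a l r ihl ihr =>
    rw [← graft_single, comul_graft, map_add, map_add, map_add, assoc_rTensor_comul_map₂,
      lTensor_comul_map₂, ihl, ihr, LinearMap.rTensor_tmul, LinearMap.lTensor_tmul, comul_graft,
      comul_nil, assoc_tmul, tmul_add]
    abel

theorem comul_coassoc (x : BinaryTree Ω →₀ K) :
    TensorProduct.assoc K _ _ _ ((comul K).rTensor _ (comul K x))
      = (comul K).lTensor _ (comul K x) := by
  refine tree_induction x (fun _ _ h h' => by simp [h, h']) (fun _ _ h => by simp [h]) fun s => ?_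
  exact comul_coassoc_of_basis K s

end DecoratedTree

end

/-! ### Typed trees as decorated trees -/

noncomputable section

open BinaryTree TensorProduct DecoratedTree
open Finsupp hiding some

namespace TypedTree

variable {Ω : Type*} [EDS Ω] (hΩ : EDS.Nondegenerate Ω)

/-- The decorated tree that represents `α ⊗ T`. Nondegeneracy is used to recover, from the type of
the root and of an edge at the root, the decoration of the root and the type of the subtree. -/
def encode : TypedTree Ω → Ω → BinaryTree Ω
  | vertex, a => node a nil nil
  | left T₁ α, a =>
      let p := (Equiv.ofBijective _ hΩ.2).symm (a, α)
      node p.2 (encode T₁ p.1) nil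
  | right β T₂, a =>
      let q := (Equiv.ofBijective _ hΩ.1).symm (a, β)
      node q.1 nil (encode T₂ q.2)
  | both T₁ α β T₂, a =>
      let q := (Equiv.ofBijective _ hΩ.1).symm (a, β)
      let p := (Equiv.ofBijective _ hΩ.2).symm (q.1, α)
      node p.2 (encode T₁ p.1) (encode T₂ q.2)

theorem encode_left {a α d ω : Ω} (T : TypedTree Ω) (h₁ : a = d ⇀ ω) (h₂ : α = d ▷ₑ ω) :
    encode hΩ (left T α) a = node ω (encode hΩ T d) nil := by
  have h : (Equiv.ofBijective _ hΩ.2).symm (a, α) = (d, ω) := by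
    rw [Equiv.symm_apply_eq, h₁, h₂]; rfl
  simp [encode, h]

theorem encode_right {a β c ω : Ω} (T : TypedTree Ω) (h₁ : a = ω ↼ c) (h₂ : β = ω ◁ₑ c) :
    encode hΩ (right β T) a = node ω nil (encode hΩ T c) := by
  have h : (Equiv.ofBijective _ hΩ.1).symm (a, β) = (ω, c) := by
    rw [Equiv.symm_apply_eq, h₁, h₂]; rfl
  simp [encode, h]

theorem encode_both {a α β c d ω : Ω} (T₁ T₂ : TypedTree Ω) (h₁ : a = (d ⇀ ω) ↼ c)
    (h₂ : α = d ▷ₑ ω) (h₃ : β = (d ⇀ ω) ◁ₑ c) :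
    encode hΩ (both T₁ α β T₂) a = node ω (encode hΩ T₁ d) (encode hΩ T₂ c) := by
  have h : (Equiv.ofBijective _ hΩ.1).symm (a, β) = (d ⇀ ω, c) := by
    rw [Equiv.symm_apply_eq, h₁, h₃]; rfl
  have h' : (Equiv.ofBijective _ hΩ.2).symm (d ⇀ ω, α) = (d, ω) := by
    rw [Equiv.symm_apply_eq, h₂]; rfl
  simp [encode, h, h']

/-- The typed tree with its extra type at the root obtained by joining at a vertex of type `ω` two
typed trees, each of them possibly empty. -/
def join (ω : Ω) : Option (Ω × TypedTree Ω) → Option (Ω × TypedTree Ω) → Ω × TypedTree Ω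
  | none, none => (ω, vertex)
  | some p, none => (p.1 ⇀ ω, left p.2 (p.1 ▷ₑ ω))
  | none, some q => (ω ↼ q.1, right (ω ◁ₑ q.1) q.2)
  | some p, some q => ((p.1 ⇀ ω) ↼ q.1, both p.2 (p.1 ▷ₑ ω) ((p.1 ⇀ ω) ◁ₑ q.1) q.2)

/-- The inverse of `encode`; the empty tree has no typed counterpart. -/
def decode : BinaryTree Ω → Option (Ω × TypedTree Ω)
  | nil => none
  | node ω l r => some (join ω (decode l) (decode r))

include hΩ in
theorem exists_left_types (a α : Ω) : ∃ d ω : Ω, a = d ⇀ ω ∧ α = d ▷ₑ ω := by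
  obtain ⟨⟨d, ω⟩, h⟩ := hΩ.2.surjective (a, α)
  exact ⟨d, ω, (congrArg Prod.fst h).symm, (congrArg Prod.snd h).symm⟩

include hΩ in
theorem exists_right_types (a β : Ω) : ∃ ω c : Ω, a = ω ↼ c ∧ β = ω ◁ₑ c := by
  obtain ⟨⟨ω, c⟩, h⟩ := hΩ.1.surjective (a, β)
  exact ⟨ω, c, (congrArg Prod.fst h).symm, (congrArg Prod.snd h).symm⟩

include hΩ in
theorem exists_both_types (a α β : Ω) :
    ∃ d ω c : Ω, a = (d ⇀ ω) ↼ c ∧ α = d ▷ₑ ω ∧ β = (d ⇀ ω) ◁ₑ c := by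
  obtain ⟨η, c, rfl, rfl⟩ := exists_right_types hΩ a β
  obtain ⟨d, ω, rfl, rfl⟩ := exists_left_types hΩ η α
  exact ⟨d, ω, c, rfl, rfl, rfl⟩

theorem decode_encode (T : TypedTree Ω) (a : Ω) : decode (encode hΩ T a) = some (a, T) := by
  induction T generalizing a with
  | vertex => simp [encode, decode, join]
  | left T₁ α ih =>
    obtain ⟨d, ω, rfl, rfl⟩ := exists_left_types hΩ a α
    simp [encode_left hΩ T₁ rfl rfl, decode, ih, join]
  | right β T₂ ih =>
    obtain ⟨ω, c, rfl, rfl⟩ := exists_right_types hΩ a β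
    simp [encode_right hΩ T₂ rfl rfl, decode, ih, join]
  | both T₁ α β T₂ ih₁ ih₂ =>
    obtain ⟨d, ω, c, rfl, rfl, rfl⟩ := exists_both_types hΩ a α β
    simp [encode_both hΩ T₁ T₂ rfl rfl rfl, decode, ih₁, ih₂, join]

/-- Every nonempty decorated tree represents a typed tree. -/
theorem eq_nil_or_eq_encode (t : BinaryTree Ω) : t = nil ∨ ∃ T a, t = encode hΩ T a := by
  induction t with
  | nil => exact Or.inl rfl
  | node ω l r ihl ihr =>
    right
    rcases ihl with rfl | ⟨T₁, d, rfl⟩ <;> rcases ihr with rfl | ⟨T₂, c, rfl⟩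
    · exact ⟨vertex, ω, rfl⟩
    · exact ⟨_, _, (encode_right hΩ T₂ rfl rfl).symm⟩
    · exact ⟨_, _, (encode_left hΩ T₁ rfl rfl).symm⟩
    · exact ⟨_, _, (encode_both hΩ T₁ T₂ rfl rfl rfl).symm⟩

end TypedTree

namespace TreeSpace

open TypedTree

variable {K Ω : Type*} [Field K]

/-- A property stable under linear combinations holds everywhere once it holds on the basis. -/
@[elab_as_elim]
theorem basis_induction {C : TreeSpace K Ω → Prop} (x : TreeSpace K Ω)
    (zero : C 0) (add : ∀ x y, C x → C y → C (x + y)) (smul : ∀ (c : K) x, C x → C (c • x))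
    (basis : ∀ α T, C (treeBasis K α T)) : C x := by
  induction x using TensorProduct.induction_on with
  | zero => exact zero
  | add x y hx hy => exact add x y hx hy
  | tmul u v =>
    induction u using Finsupp.induction_linear with
    | zero => simpa using zero
    | add f g hf hg => rw [add_tmul]; exact add _ _ hf hg
    | single a c =>
      induction v using Finsupp.induction_linear with
      | zero => simpa using zero
      | add f g hf hg => rw [tmul_add]; exact add _ _ hf hg
      | single T d =>
        have h : single a c ⊗ₜ[K] single T d = (c * d) • treeBasis K a T := by
          rw [treeBasis, ← smul_tmul_smul]
          simp
        rw [h]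
        exact smul _ _ (basis a T)


theorem treePrec_basis [FourProducts Ω] (a c : Ω) (S T : TypedTree Ω) :
    treePrec K Ω (treeBasis K a S) (treeBasis K c T)
      = single (a ↼ c) 1 ⊗ₜ TypedTree.prec K (a ◁ₑ c) S T := by
  simp only [treeBasis, treePrec]
  rw [typedTensorProduct_tmul]
  simp [precLin]

theorem treeSucc_basis [FourProducts Ω] (a c : Ω) (S T : TypedTree Ω) :
    treeSucc K Ω (treeBasis K a S) (treeBasis K c T)
      = single (a ⇀ c) 1 ⊗ₜ TypedTree.succ K (a ▷ₑ c) S T := by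
  simp only [treeBasis, treeSucc]
  rw [typedTensorProduct_tmul]
  simp [succLin]

variable [EDS Ω] (hΩ : EDS.Nondegenerate Ω)

/-- The embedding of `KΩ ⊗ K𝒯⁺_Ω` into the space of decorated trees. -/
def toDecorated : TreeSpace K Ω →ₗ[K] (BinaryTree Ω →₀ K) :=
  TensorProduct.lift (linearCombination K fun a => linearCombination K fun T =>
    single (encode hΩ T a) 1)

/-- The projection of the space of decorated trees onto `KΩ ⊗ K𝒯⁺_Ω`; it kills the empty tree. -/
def ofDecorated : (BinaryTree Ω →₀ K) →ₗ[K] TreeSpace K Ω :=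
  linearCombination K fun t => (decode t).elim 0 fun p => treeBasis K p.1 p.2

@[simp] theorem toDecorated_basis (a : Ω) (T : TypedTree Ω) :
    toDecorated hΩ (treeBasis K a T) = single (encode hΩ T a) 1 := by
  simp [toDecorated, treeBasis]

theorem toDecorated_single (a : Ω) (T : TypedTree Ω) :
    toDecorated hΩ (single a 1 ⊗ₜ[K] single T 1) = single (encode hΩ T a) 1 :=
  toDecorated_basis hΩ a T

@[simp] theorem ofDecorated_nil : ofDecorated (K := K) (single (nil : BinaryTree Ω) 1) = 0 := by
  simp [ofDecorated, decode]

theorem ofDecorated_encode (a : Ω) (T : TypedTree Ω) :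
    ofDecorated (single (encode hΩ T a) 1) = treeBasis K a T := by
  simp [ofDecorated, decode_encode]

@[simp] theorem ofDecorated_toDecorated (x : TreeSpace K Ω) :
    ofDecorated (toDecorated hΩ x) = x := by
  refine basis_induction x (by simp) (fun _ _ h h' => by simp [h, h']) (fun _ _ h => by simp [h])
    fun a T => ?_
  rw [toDecorated_basis, ofDecorated_encode]

theorem toDecorated_ofDecorated (x : BinaryTree Ω →₀ K) :
    toDecorated hΩ (ofDecorated x) = x - counit K x • single nil 1 := by
  refine tree_induction x (fun _ _ h h' => ?_) (fun _ _ h => ?_) fun t => ?_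
  · simp only [map_add, h, h', add_smul]; abel
  · simp only [map_smul, h, smul_sub, smul_assoc]
  rcases eq_nil_or_eq_encode hΩ t with rfl | ⟨T, a, rfl⟩
  · rw [ofDecorated_nil, counit_nil]; simp
  · have h : counit K (single (encode hΩ T a) 1) = 0 := by
      cases T <;> exact counit_node K _ _ _
    rw [ofDecorated_encode, toDecorated_basis, h, zero_smul, sub_zero]

@[simp] theorem counit_toDecorated (x : TreeSpace K Ω) : counit K (toDecorated hΩ x) = 0 := by
  refine basis_induction x (by simp) (fun _ _ h h' => by simp [h, h']) (fun _ _ h => by simp [h])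
    fun a T => ?_
  rw [toDecorated_basis]
  cases T <;> exact counit_node K _ _ _

theorem toDecorated_mapDomain {a c : Ω} {f : TypedTree Ω → TypedTree Ω}
    (g : (BinaryTree Ω →₀ K) →ₗ[K] (BinaryTree Ω →₀ K))
    (h : ∀ U, single (encode hΩ (f U) a) 1 = g (single (encode hΩ U c) 1))
    (x : TypedTree Ω →₀ K) :
    toDecorated hΩ (single a 1 ⊗ₜ[K] mapDomain f x)
      = g (toDecorated hΩ (single c 1 ⊗ₜ[K] x)) := by
  induction x using Finsupp.induction_linear with
  | zero => simp
  | add f g hf hg => simp only [mapDomain_add, tmul_add, map_add, hf, hg]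
  | single t d =>
    rw [mapDomain_single, ← mul_one d, ← smul_eq_mul, ← smul_single, ← smul_single, tmul_smul,
      tmul_smul, map_smul, map_smul, map_smul, toDecorated_single, toDecorated_single, h]

/-- The defining recursions of the typed products are those of the products of decorated trees;
this is where the axioms of an extended diassociative semigroup enter. -/
theorem toDecorated_products (S T : TypedTree Ω) :
    (∀ a c : Ω, toDecorated hΩ (single (a ↼ c) 1 ⊗ₜ[K] TypedTree.prec K (a ◁ₑ c) S T)
      = prec K (single (encode hΩ S a) 1) (single (encode hΩ T c) 1)) ∧
    (∀ a c : Ω, toDecorated hΩ (single (a ⇀ c) 1 ⊗ₜ[K] TypedTree.succ K (a ▷ₑ c) S T)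
      = succ K (single (encode hΩ S a) 1) (single (encode hΩ T c) 1)) := by
  induction hn : S.numVertices + T.numVertices using Nat.strong_induction_on
    generalizing S T with
  | _ n ih =>
    subst hn
    have hmul : ∀ S' T' : TypedTree Ω,
        S'.numVertices + T'.numVertices < S.numVertices + T.numVertices → ∀ a c : Ω,
        mul K (single (encode hΩ S' a) 1) (single (encode hΩ T' c) 1)
          = toDecorated hΩ (single (a ↼ c) 1 ⊗ₜ[K] TypedTree.prec K (a ◁ₑ c) S' T')
            + toDecorated hΩ (single (a ⇀ c) 1 ⊗ₜ[K] TypedTree.succ K (a ▷ₑ c) S' T') := by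
      intro S' T' hlt a c
      rw [mul_eq, ← (ih _ hlt S' T' rfl).1, ← (ih _ hlt S' T' rfl).2, ← toDecorated_basis hΩ a S',
        counit_toDecorated]
      simp
    constructor
    · intro a c
      cases S with
      | vertex =>
        rw [TypedTree.prec, toDecorated_single, encode_right hΩ T rfl rfl, encode, ← graft_single,
          ← graft_single, prec_graft, mul_single_nil_left]
      | left T₁ α =>
        obtain ⟨d, ω, rfl, rfl⟩ := exists_left_types hΩ a α
        rw [TypedTree.prec, toDecorated_single, encode_both hΩ T₁ T rfl rfl rfl,
          encode_left hΩ T₁ rfl rfl, ← graft_single, ← graft_single, prec_graft,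
          mul_single_nil_left]
      | right β T₂ =>
        obtain ⟨ω, e, rfl, rfl⟩ := exists_right_types hΩ a β
        rw [TypedTree.prec, encode_right hΩ T₂ rfl rfl, ← graft_single, prec_graft,
          hmul T₂ T (by simp only [numVertices]; omega), map_add, tmul_add, map_add,
          EDS.lt_la, EDS.lt_lt, EDS.lt_ra, EDS.lt_rt]
        congr 1
        · refine toDecorated_mapDomain hΩ _ (fun U => ?_) _
          rw [graft_single, encode_right hΩ U (EDS.la_assoc _ _ _) rfl]
        · refine toDecorated_mapDomain hΩ _ (fun U => ?_) _
          rw [graft_single, encode_right hΩ U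
            ((EDS.la_assoc _ _ _).trans (EDS.la_la_eq_la_ra _ _ _)) rfl]
      | both T₁ α β T₂ =>
        obtain ⟨d, ω, e, rfl, rfl, rfl⟩ := exists_both_types hΩ a α β
        rw [TypedTree.prec, encode_both hΩ T₁ T₂ rfl rfl rfl, ← graft_single, prec_graft,
          hmul T₂ T (by simp only [numVertices]; omega), map_add, tmul_add, map_add,
          EDS.lt_la, EDS.lt_lt, EDS.lt_ra, EDS.lt_rt]
        congr 1
        · refine toDecorated_mapDomain hΩ _ (fun U => ?_) _
          rw [graft_single, encode_both hΩ T₁ U (EDS.la_assoc _ _ _) rfl rfl]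
        · refine toDecorated_mapDomain hΩ _ (fun U => ?_) _
          rw [graft_single, encode_both hΩ T₁ U
            ((EDS.la_assoc _ _ _).trans (EDS.la_la_eq_la_ra _ _ _)) rfl rfl]
    · intro a c
      cases T with
      | vertex =>
        rw [TypedTree.succ, toDecorated_single, encode_left hΩ S rfl rfl, encode, ← graft_single,
          ← graft_single, succ_graft, mul_single_nil_right]
      | right γ T₂ =>
        obtain ⟨ω, e, rfl, rfl⟩ := exists_right_types hΩ c γ
        rw [TypedTree.succ, toDecorated_single,
          encode_both hΩ S T₂ (EDS.ra_la_assoc a ω e).symm (EDS.rt_la _ _ _)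
            (EDS.ra_lt _ _ _).symm,
          encode_right hΩ T₂ rfl rfl, ← graft_single, ← graft_single, succ_graft,
          mul_single_nil_right]
      | left T₁ β =>
        obtain ⟨d, ω, rfl, rfl⟩ := exists_left_types hΩ c β
        rw [TypedTree.succ, encode_left hΩ T₁ rfl rfl, ← graft_single, succ_graft,
          hmul S T₁ (by simp only [numVertices]; omega), map_add, LinearMap.add_apply, tmul_add,
          map_add, EDS.rt_ra_rt, EDS.rt_rt_rt, EDS.rt_la_rt, EDS.rt_lt_rt, add_comm]
        congr 1
        · refine toDecorated_mapDomain hΩ ((graft K ω).flip _) (fun U => ?_) _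
          rw [LinearMap.flip_apply, graft_single, encode_left hΩ U
            (EDS.la_ra_eq_ra_ra _ _ _).symm rfl]
        · refine toDecorated_mapDomain hΩ ((graft K ω).flip _) (fun U => ?_) _
          rw [LinearMap.flip_apply, graft_single, encode_left hΩ U
            ((EDS.ra_ra_eq_la_ra _ _ _).trans (EDS.la_ra_eq_ra_ra _ _ _)).symm rfl]
      | both T₁ β γ T₂ =>
        obtain ⟨d, ω, e, rfl, rfl, rfl⟩ := exists_both_types hΩ c β γ
        rw [TypedTree.succ, encode_both hΩ T₁ T₂ rfl rfl rfl, ← graft_single, succ_graft,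
          hmul S T₁ (by simp only [numVertices]; omega), map_add, LinearMap.add_apply, tmul_add,
          map_add, EDS.rt_la, EDS.rt_ra_rt, EDS.rt_rt_rt, EDS.rt_la_rt, EDS.rt_lt_rt, add_comm]
        congr 1
        · refine toDecorated_mapDomain hΩ ((graft K ω).flip _) (fun U => ?_) _
          rw [LinearMap.flip_apply, graft_single, encode_both hΩ U T₂ _ rfl]
          · simp only [EDS.ra_lt]
          · rw [EDS.la_ra_eq_ra_ra, EDS.ra_la_assoc a]
        · refine toDecorated_mapDomain hΩ ((graft K ω).flip _) (fun U => ?_) _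
          rw [LinearMap.flip_apply, graft_single, encode_both hΩ U T₂ _ rfl]
          · simp only [EDS.ra_lt]
          · rw [EDS.ra_ra_eq_la_ra, EDS.la_ra_eq_ra_ra, EDS.ra_la_assoc a]

theorem toDecorated_treePrec (x y : TreeSpace K Ω) :
    toDecorated hΩ (treePrec K Ω x y) = prec K (toDecorated hΩ x) (toDecorated hΩ y) := by
  refine basis_induction x (by simp) (fun _ _ h h' => by simp [h, h']) (fun _ _ h => by simp [h])
    fun a S => ?_
  refine basis_induction y (by simp) (fun _ _ h h' => by simp [h, h']) (fun _ _ h => by simp [h])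
    fun c T => ?_
  rw [treePrec_basis, (toDecorated_products hΩ S T).1, toDecorated_basis, toDecorated_basis]

theorem toDecorated_treeSucc (x y : TreeSpace K Ω) :
    toDecorated hΩ (treeSucc K Ω x y) = succ K (toDecorated hΩ x) (toDecorated hΩ y) := by
  refine basis_induction x (by simp) (fun _ _ h h' => by simp [h, h']) (fun _ _ h => by simp [h])
    fun a S => ?_
  refine basis_induction y (by simp) (fun _ _ h h' => by simp [h, h']) (fun _ _ h => by simp [h])
    fun c T => ?_
  rw [treeSucc_basis, (toDecorated_products hΩ S T).2, toDecorated_basis, toDecorated_basis]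

end TreeSpace

end

/-! ### The coproduct on `KΩ ⊗ K𝒯⁺_Ω` -/

noncomputable section

open BinaryTree TensorProduct DecoratedTree TypedTree
open Finsupp hiding some

namespace TreeSpace

variable {K Ω : Type*} [Field K] [EDS Ω] (hΩ : EDS.Nondegenerate Ω)

theorem toDecorated_injective :
    Function.Injective (toDecorated (K := K) hΩ) :=
  Function.LeftInverse.injective (ofDecorated_toDecorated hΩ)

theorem toDecorated_mul (x y : TreeSpace K Ω) :
    toDecorated hΩ (treePrec K Ω x y + treeSucc K Ω x y)
      = mul K (toDecorated hΩ x) (toDecorated hΩ y) := by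
  rw [map_add, toDecorated_treePrec, toDecorated_treeSucc, mul_eq, counit_toDecorated, zero_mul,
    zero_smul, add_zero]

include hΩ in
theorem isDendriform : IsDendriform (K := K) (A := TreeSpace K Ω) (treePrec K Ω) (treeSucc K Ω) where
  prec_prec x y z := toDecorated_injective hΩ <| by
    simp only [toDecorated_treePrec, toDecorated_mul, prec_prec]
  succ_prec x y z := toDecorated_injective hΩ <| by
    simp only [toDecorated_treePrec, toDecorated_treeSucc, succ_prec]
  succ_succ x y z := toDecorated_injective hΩ <| by
    simp only [toDecorated_treeSucc, toDecorated_mul, succ_succ]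

theorem ofDecorated_prec (x y : TreeSpace K Ω) :
    ofDecorated (prec K (toDecorated hΩ x) (toDecorated hΩ y)) = treePrec K Ω x y := by
  rw [← toDecorated_treePrec, ofDecorated_toDecorated]

theorem ofDecorated_succ (x y : TreeSpace K Ω) :
    ofDecorated (succ K (toDecorated hΩ x) (toDecorated hΩ y)) = treeSucc K Ω x y := by
  rw [← toDecorated_treeSucc, ofDecorated_toDecorated]

theorem ofDecorated_mul (x y : TreeSpace K Ω) :
    ofDecorated (mul K (toDecorated hΩ x) (toDecorated hΩ y))
      = treePrec K Ω x y + treeSucc K Ω x y := by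
  rw [← toDecorated_mul, ofDecorated_toDecorated]

theorem prec_toDecorated_nil (x : TreeSpace K Ω) :
    prec K (toDecorated hΩ x) (single nil 1) = toDecorated hΩ x := by
  have h := mul_eq K (toDecorated hΩ x) (single nil 1)
  rwa [mul_single_nil_right, succ_nil_right, counit_toDecorated, zero_mul, zero_smul, add_zero,
    add_zero, eq_comm] at h

theorem succ_nil_toDecorated (x : TreeSpace K Ω) :
    succ K (single nil 1) (toDecorated hΩ x) = toDecorated hΩ x := by
  have h := mul_eq K (single nil 1) (toDecorated hΩ x)
  rwa [mul_single_nil_left, prec_nil_left, counit_toDecorated, mul_zero, zero_smul, zero_add,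
    add_zero, eq_comm] at h

/-- The coproduct: the reduced part of the counital coproduct of decorated trees. -/
def reducedComul : TreeSpace K Ω →ₗ[K] TreeSpace K Ω ⊗[K] TreeSpace K Ω :=
  TensorProduct.map ofDecorated ofDecorated ∘ₗ comul K ∘ₗ toDecorated hΩ

theorem reducedComul_apply (x : TreeSpace K Ω) :
    reducedComul hΩ x = TensorProduct.map ofDecorated ofDecorated (comul K (toDecorated hΩ x)) :=
  rfl

/-- The projection from decorated trees is a morphism of coalgebras. -/
theorem reducedComul_ofDecorated (x : BinaryTree Ω →₀ K) :
    reducedComul hΩ (ofDecorated x) = TensorProduct.map ofDecorated ofDecorated (comul K x) := by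
  have h : x = toDecorated hΩ (ofDecorated x) + counit K x • single nil 1 := by
    rw [toDecorated_ofDecorated, sub_add_cancel]
  conv_rhs => rw [h]
  rw [reducedComul_apply, map_add, map_add, map_smul, map_smul, comul_nil, map_tmul,
    ofDecorated_nil, zero_tmul, smul_zero, add_zero]

theorem reducedComul_vertex (a : Ω) : reducedComul (K := K) hΩ (treeBasis K a vertex) = 0 := by
  rw [reducedComul_apply, toDecorated_basis, encode, ← graft_single, comul_graft, comul_nil,
    map₂_apply_tmul, map_tmul, mul_single_nil_left, map_add, map_tmul, map_tmul, ofDecorated_nil,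
    zero_tmul, tmul_zero, add_zero]

theorem reducedComul_coassoc (x : TreeSpace K Ω) :
    TensorProduct.assoc K _ _ _ ((reducedComul hΩ).rTensor _ (reducedComul hΩ x))
      = (reducedComul hΩ).lTensor _ (reducedComul hΩ x) := by
  have hr : ∀ Z : (BinaryTree Ω →₀ K) ⊗[K] (BinaryTree Ω →₀ K),
      (reducedComul hΩ).rTensor _ (TensorProduct.map ofDecorated ofDecorated Z)
        = TensorProduct.map (TensorProduct.map ofDecorated ofDecorated) ofDecorated
            ((comul K).rTensor _ Z) := by
    intro Z
    induction Z using TensorProduct.induction_on with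
    | zero => simp
    | add Z Z' h h' => simp only [map_add, h, h']
    | tmul u v => simp [reducedComul_ofDecorated]
  have hl : ∀ Z : (BinaryTree Ω →₀ K) ⊗[K] (BinaryTree Ω →₀ K),
      (reducedComul hΩ).lTensor _ (TensorProduct.map ofDecorated ofDecorated Z)
        = TensorProduct.map ofDecorated (TensorProduct.map ofDecorated ofDecorated)
            ((comul K).lTensor _ Z) := by
    intro Z
    induction Z using TensorProduct.induction_on with
    | zero => simp
    | add Z Z' h h' => simp only [map_add, h, h']
    | tmul u v => simp [reducedComul_ofDecorated]
  rw [reducedComul_apply, hr, hl, ← comul_coassoc, map_map_assoc]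

/-- The counital coproduct of the embedded space, in terms of the reduced one:
`Δ̄ x = x ⊗ 1 + 1 ⊗ x + Δ x`. -/
theorem comul_toDecorated (x : TreeSpace K Ω) :
    comul K (toDecorated hΩ x) = toDecorated hΩ x ⊗ₜ single nil 1
      + single nil 1 ⊗ₜ toDecorated hΩ x
      + TensorProduct.map (toDecorated hΩ) (toDecorated hΩ) (reducedComul hΩ x) := by
  have h : ∀ Z : (BinaryTree Ω →₀ K) ⊗[K] (BinaryTree Ω →₀ K),
      TensorProduct.map (toDecorated hΩ) (toDecorated hΩ)
          (TensorProduct.map ofDecorated ofDecorated Z)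
        = Z - single nil 1 ⊗ₜ TensorProduct.lid K _ ((counit K).rTensor _ Z)
          - TensorProduct.rid K _ ((counit K).lTensor _ Z) ⊗ₜ single nil 1
          + counit K (TensorProduct.rid K _ ((counit K).lTensor _ Z))
              • single nil 1 ⊗ₜ single nil 1 := by
    intro Z
    induction Z using TensorProduct.induction_on with
    | zero => simp
    | add Z Z' h h' => simp only [map_add, h, h', tmul_add, add_tmul, add_smul]; abel
    | tmul u v =>
      simp only [map_tmul, toDecorated_ofDecorated, LinearMap.rTensor_tmul, LinearMap.lTensor_tmul,
        lid_tmul, rid_tmul, map_smul, sub_tmul, tmul_sub, smul_tmul, tmul_smul, smul_eq_mul,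
        mul_smul, smul_sub]
      abel
  rw [reducedComul_apply, h, rTensor_counit_comul, lTensor_counit_comul, lid_tmul, rid_tmul]
  simp only [one_smul, counit_toDecorated, zero_smul]
  abel

section Components

variable {f : (BinaryTree Ω →₀ K) →ₗ[K] (BinaryTree Ω →₀ K) →ₗ[K] (BinaryTree Ω →₀ K)}
  {g : TreeSpace K Ω →ₗ[K] TreeSpace K Ω →ₗ[K] TreeSpace K Ω}
  (hfg : ∀ x y, ofDecorated (f (toDecorated hΩ x) (toDecorated hΩ y)) = g x y)

include hfg

/-- The contribution of `Δ x` and `Δ y` to `Δ̄(x ≺ y)` or `Δ̄(x ≻ y)`; the next lemmas give the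
contributions of the other pairs of terms of `Δ̄ x` and `Δ̄ y`, in which a unit occurs. -/
theorem map_map₂_reduced_reduced (U W : TreeSpace K Ω ⊗[K] TreeSpace K Ω) :
    TensorProduct.map ofDecorated ofDecorated (map₂ f (mul K)
        (TensorProduct.map (toDecorated hΩ) (toDecorated hΩ) U)
        (TensorProduct.map (toDecorated hΩ) (toDecorated hΩ) W))
      = map₂ g (treePrec K Ω + treeSucc K Ω) U W := by
  induction U using TensorProduct.induction_on with
  | zero => simp only [map_zero, LinearMap.zero_apply]
  | add U U' h h' => simp only [map_add, LinearMap.add_apply, h, h']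
  | tmul u u' =>
    induction W using TensorProduct.induction_on with
    | zero => simp only [map_zero]
    | add W W' h h' => simp only [map_add, h, h']
    | tmul w w' =>
      simp only [map₂_apply_tmul, map_tmul, hfg, ofDecorated_mul, LinearMap.add_apply]

theorem map_map₂_left_reduced (x : TreeSpace K Ω) (W : TreeSpace K Ω ⊗[K] TreeSpace K Ω) :
    TensorProduct.map ofDecorated ofDecorated (map₂ f (mul K)
        (toDecorated hΩ x ⊗ₜ single nil 1)
        (TensorProduct.map (toDecorated hΩ) (toDecorated hΩ) W))
      = (g x).rTensor _ W := by
  induction W using TensorProduct.induction_on with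
  | zero => simp only [map_zero]
  | add W W' h h' => simp only [map_add, h, h']
  | tmul w w' =>
    simp only [map₂_apply_tmul, map_tmul, hfg, mul_single_nil_left, LinearMap.rTensor_tmul,
      ofDecorated_toDecorated]

theorem map_map₂_reduced_left (U : TreeSpace K Ω ⊗[K] TreeSpace K Ω) (y : TreeSpace K Ω) :
    TensorProduct.map ofDecorated ofDecorated (map₂ f (mul K)
        (TensorProduct.map (toDecorated hΩ) (toDecorated hΩ) U)
        (toDecorated hΩ y ⊗ₜ single nil 1))
      = (g.flip y).rTensor _ U := by
  induction U using TensorProduct.induction_on with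
  | zero => simp only [map_zero, LinearMap.zero_apply]
  | add U U' h h' => simp only [map_add, LinearMap.add_apply, h, h']
  | tmul u u' =>
    simp only [map₂_apply_tmul, map_tmul, hfg, mul_single_nil_right, LinearMap.rTensor_tmul,
      ofDecorated_toDecorated, LinearMap.flip_apply]

end Components

theorem map_map₂_prec_reduced_right (U : TreeSpace K Ω ⊗[K] TreeSpace K Ω) (y : TreeSpace K Ω) :
    TensorProduct.map ofDecorated ofDecorated (map₂ (prec K) (mul K)
        (TensorProduct.map (toDecorated hΩ) (toDecorated hΩ) U)
        (single nil 1 ⊗ₜ toDecorated hΩ y))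
      = ((treePrec K Ω + treeSucc K Ω).flip y).lTensor _ U := by
  induction U using TensorProduct.induction_on with
  | zero => simp only [map_zero, LinearMap.zero_apply]
  | add U U' h h' => simp only [map_add, LinearMap.add_apply, h, h']
  | tmul u u' =>
    simp only [map₂_apply_tmul, map_tmul, prec_toDecorated_nil, ofDecorated_mul,
      LinearMap.lTensor_tmul, ofDecorated_toDecorated, LinearMap.flip_apply, LinearMap.add_apply]

theorem map_map₂_succ_right_reduced (x : TreeSpace K Ω) (W : TreeSpace K Ω ⊗[K] TreeSpace K Ω) :
    TensorProduct.map ofDecorated ofDecorated (map₂ (succ K) (mul K)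
        (single nil 1 ⊗ₜ toDecorated hΩ x)
        (TensorProduct.map (toDecorated hΩ) (toDecorated hΩ) W))
      = ((treePrec K Ω + treeSucc K Ω) x).lTensor _ W := by
  induction W using TensorProduct.induction_on with
  | zero => simp only [map_zero]
  | add W W' h h' => simp only [map_add, h, h']
  | tmul w w' =>
    simp only [map₂_apply_tmul, map_tmul, succ_nil_toDecorated, ofDecorated_mul,
      LinearMap.lTensor_tmul, ofDecorated_toDecorated, LinearMap.add_apply]

theorem reducedComul_treePrec (x y : TreeSpace K Ω) :
    reducedComul hΩ (treePrec K Ω x y) = x ⊗ₜ[K] y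
      + ((treePrec K Ω).flip y).rTensor _ (reducedComul hΩ x)
      + ((treePrec K Ω + treeSucc K Ω).flip y).lTensor _ (reducedComul hΩ x)
      + (treePrec K Ω x).rTensor _ (reducedComul hΩ y)
      + TensorProduct.map₂ (treePrec K Ω) (treePrec K Ω + treeSucc K Ω)
          (reducedComul hΩ x) (reducedComul hΩ y) := by
  rw [reducedComul_apply, toDecorated_treePrec, comul_prec, comul_toDecorated, comul_toDecorated]
  simp only [map_add, LinearMap.add_apply, map₂_prec_mul_nil_left,
    map_map₂_reduced_reduced hΩ (ofDecorated_prec hΩ),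
    map_map₂_left_reduced hΩ (ofDecorated_prec hΩ),
    map_map₂_reduced_left hΩ (ofDecorated_prec hΩ), map_map₂_prec_reduced_right]
  simp only [map₂_apply_tmul, map_tmul, prec_toDecorated_nil, mul_single_nil_left, ofDecorated_nil,
    ofDecorated_toDecorated, tmul_zero, zero_tmul, map_zero]
  abel

theorem reducedComul_treeSucc (x y : TreeSpace K Ω) :
    reducedComul hΩ (treeSucc K Ω x y) = y ⊗ₜ[K] x
      + ((treeSucc K Ω).flip y).rTensor _ (reducedComul hΩ x)
      + ((treePrec K Ω + treeSucc K Ω) x).lTensor _ (reducedComul hΩ y)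
      + (treeSucc K Ω x).rTensor _ (reducedComul hΩ y)
      + TensorProduct.map₂ (treeSucc K Ω) (treePrec K Ω + treeSucc K Ω)
          (reducedComul hΩ x) (reducedComul hΩ y) := by
  rw [reducedComul_apply, toDecorated_treeSucc, comul_succ, comul_toDecorated, comul_toDecorated]
  simp only [map_add, LinearMap.add_apply, map₂_succ_mul_nil_right,
    map_map₂_reduced_reduced hΩ (ofDecorated_succ hΩ),
    map_map₂_left_reduced hΩ (ofDecorated_succ hΩ),
    map_map₂_reduced_left hΩ (ofDecorated_succ hΩ), map_map₂_succ_right_reduced]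
  simp only [map₂_apply_tmul, map_tmul, succ_nil_toDecorated,
    mul_single_nil_right, ofDecorated_nil,
    ofDecorated_toDecorated, tmul_zero, zero_tmul, map_zero]
  abel

theorem isDendriformBialgebra : IsDendriformBialgebra (K := K) (A := TreeSpace K Ω)
    (treePrec K Ω) (treeSucc K Ω) (reducedComul hΩ) where
  dendriform := isDendriform hΩ
  coassoc := reducedComul_coassoc hΩ
  comul_prec := reducedComul_treePrec hΩ
  comul_succ := reducedComul_treeSucc hΩ

end TreeSpace

end

/-! ### Generation by the trees with one vertex, and the grading -/

noncomputable section

open TensorProduct TypedTree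
open Finsupp hiding some

namespace TypedTree

variable (K : Type*) {Ω : Type*} [Field K]

/-- The span of the trees with `n` internal vertices. -/
def homogeneous (n : ℕ) : Submodule K (TypedTree Ω →₀ K) :=
  Submodule.span K {x | ∃ T : TypedTree Ω, T.numVertices = n ∧ x = single T 1}

variable {K}

theorem single_mem_homogeneous {n : ℕ} (T : TypedTree Ω) (h : T.numVertices = n) :
    single T 1 ∈ homogeneous K n :=
  Submodule.subset_span ⟨T, h, rfl⟩

theorem mapDomain_mem_homogeneous {m n k : ℕ} {f : TypedTree Ω → TypedTree Ω}
    (hf : ∀ U, (f U).numVertices = U.numVertices + k) {x : TypedTree Ω →₀ K}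
    (hx : x ∈ homogeneous K m) (h : m + k = n) : mapDomain f x ∈ homogeneous K n := by
  induction hx using Submodule.span_induction with
  | mem x hx =>
    obtain ⟨T, rfl, rfl⟩ := hx
    rw [mapDomain_single]
    exact single_mem_homogeneous _ (by rw [hf, h])
  | zero => rw [mapDomain_zero]; exact zero_mem _
  | add x y _ _ hx hy => rw [mapDomain_add]; exact add_mem hx hy
  | smul c x _ hx => rw [mapDomain_smul]; exact Submodule.smul_mem _ _ hx

theorem products_mem_homogeneous [FourProducts Ω] (S T : TypedTree Ω) :
    (∀ γ, prec K γ S T ∈ homogeneous K (S.numVertices + T.numVertices)) ∧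
      ∀ γ, succ K γ S T ∈ homogeneous K (S.numVertices + T.numVertices) := by
  induction hn : S.numVertices + T.numVertices using Nat.strong_induction_on
    generalizing S T with
  | _ n ih =>
    subst hn
    constructor
    · intro γ
      cases S with
      | vertex =>
        rw [prec]
        exact single_mem_homogeneous _ (by simp only [numVertices]; omega)
      | left T₁ α =>
        rw [prec]
        exact single_mem_homogeneous _ (by simp only [numVertices]; omega)
      | right β T₂ =>
        obtain ⟨hp, hs⟩ := ih _ (by simp only [numVertices]; omega) T₂ T rfl
        rw [prec]
        exact add_mem
          (mapDomain_mem_homogeneous (fun U => rfl) (hp _) (by simp only [numVertices]; omega))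
          (mapDomain_mem_homogeneous (fun U => rfl) (hs _) (by simp only [numVertices]; omega))
      | both T₁ α β T₂ =>
        obtain ⟨hp, hs⟩ := ih _ (by simp only [numVertices]; omega) T₂ T rfl
        rw [prec]
        exact add_mem
          (mapDomain_mem_homogeneous (k := T₁.numVertices + 1)
            (fun U => by simp only [numVertices]; omega) (hp _) (by simp only [numVertices]; omega))
          (mapDomain_mem_homogeneous (k := T₁.numVertices + 1)
            (fun U => by simp only [numVertices]; omega) (hs _) (by simp only [numVertices]; omega))
    · intro γ
      cases T with
      | vertex =>
        rw [succ]
        exact single_mem_homogeneous _ (by simp only [numVertices])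
      | right β T₂ =>
        rw [succ]
        exact single_mem_homogeneous _ (by simp only [numVertices]; omega)
      | left T₁ β =>
        obtain ⟨hp, hs⟩ := ih _ (by simp only [numVertices]; omega) S T₁ rfl
        rw [succ]
        exact add_mem
          (mapDomain_mem_homogeneous (fun U => rfl) (hs _) (by simp only [numVertices]; omega))
          (mapDomain_mem_homogeneous (fun U => rfl) (hp _) (by simp only [numVertices]; omega))
      | both T₁ α β T₂ =>
        obtain ⟨hp, hs⟩ := ih _ (by simp only [numVertices]; omega) S T₁ rfl
        rw [succ]
        exact add_mem
          (mapDomain_mem_homogeneous (k := T₂.numVertices + 1)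
            (fun U => by simp only [numVertices]; omega) (hs _) (by simp only [numVertices]; omega))
          (mapDomain_mem_homogeneous (k := T₂.numVertices + 1)
            (fun U => by simp only [numVertices]; omega) (hp _) (by simp only [numVertices]; omega))

end TypedTree

namespace TreeSpace

variable {K Ω : Type*} [Field K]

theorem treeBasis_mem_treeDegree (a : Ω) (T : TypedTree Ω) :
    treeBasis K a T ∈ treeDegree K Ω T.numVertices :=
  Submodule.subset_span ⟨a, T, rfl, rfl⟩

theorem single_tmul_mem_treeDegree {n : ℕ} (a : Ω) {x : TypedTree Ω →₀ K}
    (hx : x ∈ homogeneous K n) : single a 1 ⊗ₜ[K] x ∈ treeDegree K Ω n := by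
  induction hx using Submodule.span_induction with
  | mem x hx =>
    obtain ⟨T, rfl, rfl⟩ := hx
    exact treeBasis_mem_treeDegree a T
  | zero => rw [tmul_zero]; exact zero_mem _
  | add x y _ _ hx hy => rw [tmul_add]; exact add_mem hx hy
  | smul c x _ hx => rw [tmul_smul]; exact Submodule.smul_mem _ _ hx

/-- A bilinear product is homogeneous if it is so on the basis. -/
theorem apply_mem_treeDegree {f : TreeSpace K Ω →ₗ[K] TreeSpace K Ω →ₗ[K] TreeSpace K Ω}
    (hf : ∀ a S c T, f (treeBasis K a S) (treeBasis K c T)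
      ∈ treeDegree K Ω (S.numVertices + T.numVertices))
    {m n : ℕ} {x y : TreeSpace K Ω} (hx : x ∈ treeDegree K Ω m) (hy : y ∈ treeDegree K Ω n) :
    f x y ∈ treeDegree K Ω (m + n) := by
  induction hx using Submodule.span_induction with
  | mem x hx =>
    obtain ⟨a, S, rfl, rfl⟩ := hx
    induction hy using Submodule.span_induction with
    | mem y hy =>
      obtain ⟨c, T, rfl, rfl⟩ := hy
      exact hf a S c T
    | zero => rw [map_zero]; exact zero_mem _
    | add y y' _ _ h h' => rw [map_add]; exact add_mem h h'
    | smul c y _ h => rw [map_smul]; exact Submodule.smul_mem _ _ h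
  | zero => rw [map_zero]; exact zero_mem _
  | add x x' _ _ h h' => rw [map_add]; exact add_mem h h'
  | smul c x _ h => rw [map_smul]; exact Submodule.smul_mem _ _ h

theorem treePrec_mem_treeDegree [FourProducts Ω] {m n : ℕ} {x y : TreeSpace K Ω}
    (hx : x ∈ treeDegree K Ω m) (hy : y ∈ treeDegree K Ω n) :
    treePrec K Ω x y ∈ treeDegree K Ω (m + n) := by
  refine apply_mem_treeDegree (fun a S c T => ?_) hx hy
  rw [treePrec_basis]
  exact single_tmul_mem_treeDegree _ ((products_mem_homogeneous S T).1 _)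

theorem treeSucc_mem_treeDegree [FourProducts Ω] {m n : ℕ} {x y : TreeSpace K Ω}
    (hx : x ∈ treeDegree K Ω m) (hy : y ∈ treeDegree K Ω n) :
    treeSucc K Ω x y ∈ treeDegree K Ω (m + n) := by
  refine apply_mem_treeDegree (fun a S c T => ?_) hx hy
  rw [treeSucc_basis]
  exact single_tmul_mem_treeDegree _ ((products_mem_homogeneous S T).2 _)

/-- A degree function on a basis gives a direct sum decomposition. -/
theorem _root_.Module.Basis.isInternal_span_degree {A ι : Type*} [AddCommGroup A] [Module K A]
    (b : Module.Basis ι K A) (deg : ι → ℕ) :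
    DirectSum.IsInternal fun n => Submodule.span K (b '' {p | deg p = n}) := by
  refine DirectSum.isInternal_submodule_of_iSupIndep_of_iSup_eq_top ?_ ?_
  · rw [iSupIndep_def]
    intro i
    have hle : (⨆ (j) (_ : j ≠ i), Submodule.span K (b '' {p | deg p = j}))
        ≤ Submodule.span K (b '' {p | deg p ≠ i}) :=
      iSup₂_le fun j hj => Submodule.span_mono <| Set.image_mono fun p hp h =>
        hj (Eq.trans (Eq.symm hp) h)
    have hdisj : Disjoint {p | deg p = i} {p | deg p ≠ i} :=
      Set.disjoint_left.mpr fun p hp hp' => hp' hp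
    exact (b.linearIndependent.disjoint_span_image hdisj).mono_right hle
  · rw [eq_top_iff, ← b.span_eq, Submodule.span_le]
    rintro _ ⟨p, rfl⟩
    exact Submodule.mem_iSup_of_mem (deg p) (Submodule.subset_span ⟨p, rfl, rfl⟩)

variable (K Ω) in
theorem isInternal_treeDegree : DirectSum.IsInternal (treeDegree K Ω) := by
  obtain ⟨b, hb⟩ : ∃ b : Module.Basis (Ω × TypedTree Ω) K (TreeSpace K Ω),
      ∀ p, b p = treeBasis K p.1 p.2 :=
    ⟨Module.Basis.tensorProduct Finsupp.basisSingleOne Finsupp.basisSingleOne, fun p => by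
      simp [treeBasis, Module.Basis.tensorProduct_apply']⟩
  have hspan : treeDegree K Ω
      = fun n => Submodule.span K (b '' {p | p.2.numVertices = n}) := by
    funext n
    rw [treeDegree]
    congr 1
    ext x
    constructor
    · rintro ⟨a, T, h, rfl⟩
      exact ⟨(a, T), h, hb _⟩
    · rintro ⟨p, h, rfl⟩
      exact ⟨p.1, p.2, h, hb p⟩
  have h := Module.Basis.isInternal_span_degree (A := TreeSpace K Ω) b fun p => p.2.numVertices
  rw [hspan]
  exact h

/-- The degree `n` part of the tensor square. -/
def tensorDegree (K Ω : Type*) [Field K] (n : ℕ) :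
    Submodule K (TreeSpace K Ω ⊗[K] TreeSpace K Ω) :=
  ⨆ (i : ℕ) (j : ℕ) (_ : i + j = n),
    Submodule.map₂ (TensorProduct.mk K (TreeSpace K Ω) (TreeSpace K Ω))
      (treeDegree K Ω i) (treeDegree K Ω j)

theorem tmul_mem_tensorDegree {i j n : ℕ} {x y : TreeSpace K Ω} (hx : x ∈ treeDegree K Ω i)
    (hy : y ∈ treeDegree K Ω j) (h : i + j = n) : x ⊗ₜ[K] y ∈ tensorDegree K Ω n :=
  Submodule.mem_iSup_of_mem i <| Submodule.mem_iSup_of_mem j <| Submodule.mem_iSup_of_mem h <|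
    Submodule.apply_mem_map₂ _ hx hy

/-- A linear map sends the degree `n` part into a submodule if it does so on pure tensors. -/
theorem apply_mem_of_mem_tensorDegree {M : Type*} [AddCommMonoid M] [Module K M]
    {f : TreeSpace K Ω ⊗[K] TreeSpace K Ω →ₗ[K] M} {P : Submodule K M} {n : ℕ}
    (h : ∀ i j x y, i + j = n → x ∈ treeDegree K Ω i → y ∈ treeDegree K Ω j → f (x ⊗ₜ y) ∈ P)
    {Z : TreeSpace K Ω ⊗[K] TreeSpace K Ω} (hZ : Z ∈ tensorDegree K Ω n) : f Z ∈ P := by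
  have hle : tensorDegree K Ω n ≤ P.comap f :=
    iSup_le fun i => iSup_le fun j => iSup_le fun hij =>
      Submodule.map₂_le.mpr fun x hx y hy => h i j x y hij hx hy
  exact hle hZ

theorem rTensor_mem_tensorDegree {f : TreeSpace K Ω →ₗ[K] TreeSpace K Ω} {k n : ℕ}
    (hf : ∀ i x, x ∈ treeDegree K Ω i → f x ∈ treeDegree K Ω (k + i))
    {Z : TreeSpace K Ω ⊗[K] TreeSpace K Ω} (hZ : Z ∈ tensorDegree K Ω n) :
    f.rTensor _ Z ∈ tensorDegree K Ω (k + n) :=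
  apply_mem_of_mem_tensorDegree (fun i _ _ _ hij hx hy =>
    tmul_mem_tensorDegree (hf i _ hx) hy (by omega)) hZ

theorem lTensor_mem_tensorDegree {f : TreeSpace K Ω →ₗ[K] TreeSpace K Ω} {k n : ℕ}
    (hf : ∀ i x, x ∈ treeDegree K Ω i → f x ∈ treeDegree K Ω (k + i))
    {Z : TreeSpace K Ω ⊗[K] TreeSpace K Ω} (hZ : Z ∈ tensorDegree K Ω n) :
    f.lTensor _ Z ∈ tensorDegree K Ω (k + n) :=
  apply_mem_of_mem_tensorDegree (fun _ j _ _ hij hx hy =>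
    tmul_mem_tensorDegree hx (hf j _ hy) (by omega)) hZ

theorem map₂_mem_tensorDegree
    {f g : TreeSpace K Ω →ₗ[K] TreeSpace K Ω →ₗ[K] TreeSpace K Ω} {m n : ℕ}
    (hf : ∀ i j x y, x ∈ treeDegree K Ω i → y ∈ treeDegree K Ω j → f x y ∈ treeDegree K Ω (i + j))
    (hg : ∀ i j x y, x ∈ treeDegree K Ω i → y ∈ treeDegree K Ω j → g x y ∈ treeDegree K Ω (i + j))
    {Z W : TreeSpace K Ω ⊗[K] TreeSpace K Ω} (hZ : Z ∈ tensorDegree K Ω m)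
    (hW : W ∈ tensorDegree K Ω n) : map₂ f g Z W ∈ tensorDegree K Ω (m + n) := by
  refine apply_mem_of_mem_tensorDegree (f := map₂ f g Z) (fun i j x y hij hx hy => ?_) hW
  refine apply_mem_of_mem_tensorDegree (f := (map₂ f g).flip (x ⊗ₜ y))
    (fun i' j' x' y' hij' hx' hy' => ?_) hZ
  exact tmul_mem_tensorDegree (hf _ _ _ _ hx' hx) (hg _ _ _ _ hy' hy) (by omega)

variable [EDS Ω] (hΩ : EDS.Nondegenerate Ω)

include hΩ in
/-- By nondegeneracy the trees with one vertex generate `KΩ ⊗ K𝒯⁺_Ω` as a dendriform algebra, in a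
way that keeps track of the number of vertices. -/
theorem treeBasis_induction {C : ℕ → TreeSpace K Ω → Prop}
    (vertex : ∀ a, C 1 (treeBasis K a vertex))
    (prec : ∀ m n x y, C m x → C n y → C (m + n) (treePrec K Ω x y))
    (succ : ∀ m n x y, C m x → C n y → C (m + n) (treeSucc K Ω x y))
    (T : TypedTree Ω) (a : Ω) : C T.numVertices (treeBasis K a T) := by
  have hl : ∀ (d ω : Ω) (S : TypedTree Ω),
      treeSucc K Ω (treeBasis K d S) (treeBasis K ω .vertex)
        = treeBasis K (d ⇀ ω) (.left S (d ▷ₑ ω)) := by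
    intro d ω S
    rw [treeSucc_basis, TypedTree.succ, treeBasis]
  induction T generalizing a with
  | vertex => exact vertex a
  | left T₁ α ih =>
    obtain ⟨d, ω, rfl, rfl⟩ := exists_left_types hΩ a α
    rw [← hl]
    exact succ _ _ _ _ (ih d) (vertex ω)
  | right β T₂ ih =>
    obtain ⟨ω, c, rfl, rfl⟩ := exists_right_types hΩ a β
    have h := prec _ _ _ _ (vertex ω) (ih c)
    rwa [treePrec_basis, TypedTree.prec, add_comm] at h
  | both T₁ α β T₂ ih₁ ih₂ =>
    obtain ⟨d, ω, c, rfl, rfl, rfl⟩ := exists_both_types hΩ a α β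
    have h := prec _ _ _ _ (succ _ _ _ _ (ih₁ d) (vertex ω)) (ih₂ c)
    rwa [hl, treePrec_basis, TypedTree.prec, add_right_comm] at h

include hΩ in
/-- The axioms of a dendriform bialgebra determine the coproduct from its values on the generators
`α ⊗ Y`. -/
theorem comul_unique {Δ Δ' : TreeSpace K Ω →ₗ[K] TreeSpace K Ω ⊗[K] TreeSpace K Ω}
    (h : IsDendriformBialgebra (K := K) (A := TreeSpace K Ω) (treePrec K Ω) (treeSucc K Ω) Δ)
    (h' : IsDendriformBialgebra (K := K) (A := TreeSpace K Ω) (treePrec K Ω) (treeSucc K Ω) Δ')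
    (hv : ∀ a : Ω, Δ (treeBasis K a vertex) = Δ' (treeBasis K a vertex)) : Δ = Δ' := by
  refine LinearMap.ext fun x => ?_
  refine basis_induction x (by rw [map_zero, map_zero])
    (fun _ _ h h' => by rw [map_add, map_add, h, h'])
    (fun _ _ h => by rw [map_smul, map_smul, h]) fun a T => ?_
  refine treeBasis_induction hΩ (C := fun _ x => Δ x = Δ' x) hv (fun _ _ x y hx hy => ?_)
    (fun _ _ x y hx hy => ?_) T a
  · rw [h.comul_prec, h'.comul_prec, hx, hy]
  · rw [h.comul_succ, h'.comul_succ, hx, hy]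

include hΩ in
theorem isDendriformGrading {Δ : TreeSpace K Ω →ₗ[K] TreeSpace K Ω ⊗[K] TreeSpace K Ω}
    (h : IsDendriformBialgebra (K := K) (A := TreeSpace K Ω) (treePrec K Ω) (treeSucc K Ω) Δ)
    (hv : ∀ a : Ω, Δ (treeBasis K a vertex) = 0) :
    IsDendriformGrading (K := K) (A := TreeSpace K Ω) (treePrec K Ω) (treeSucc K Ω) Δ
      (treeDegree K Ω) where
  isInternal := isInternal_treeDegree K Ω
  prec_mem _ _ _ _ hx hy := treePrec_mem_treeDegree hx hy
  succ_mem _ _ _ _ hx hy := treeSucc_mem_treeDegree hx hy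
  comul_mem := by
    have hp : ∀ i j (x y : TreeSpace K Ω), x ∈ treeDegree K Ω i → y ∈ treeDegree K Ω j →
        treePrec K Ω x y ∈ treeDegree K Ω (i + j) :=
      fun _ _ _ _ => treePrec_mem_treeDegree
    have hs : ∀ i j (x y : TreeSpace K Ω), x ∈ treeDegree K Ω i → y ∈ treeDegree K Ω j →
        treeSucc K Ω x y ∈ treeDegree K Ω (i + j) :=
      fun _ _ _ _ => treeSucc_mem_treeDegree
    have hm : ∀ i j (x y : TreeSpace K Ω), x ∈ treeDegree K Ω i → y ∈ treeDegree K Ω j →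
        (treePrec K Ω + treeSucc K Ω) x y ∈ treeDegree K Ω (i + j) :=
      fun i j x y hx hy => add_mem (hp i j x y hx hy) (hs i j x y hx hy)
    have key : ∀ (T : TypedTree Ω) (a : Ω), treeBasis K a T ∈ treeDegree K Ω T.numVertices ∧
        Δ (treeBasis K a T) ∈ tensorDegree K Ω T.numVertices := by
      refine treeBasis_induction hΩ
        (C := fun n x => x ∈ treeDegree K Ω n ∧ Δ x ∈ tensorDegree K Ω n)
        (fun a => ⟨treeBasis_mem_treeDegree a vertex, ?_⟩) ?_ ?_
      · rw [hv]
        exact zero_mem _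
      · rintro m n x y ⟨hx, hΔx⟩ ⟨hy, hΔy⟩
        refine ⟨hp _ _ _ _ hx hy, ?_⟩
        rw [h.comul_prec]
        refine add_mem (add_mem (add_mem (add_mem ?_ ?_) ?_) ?_) ?_
        · exact tmul_mem_tensorDegree hx hy rfl
        · rw [add_comm m]
          exact rTensor_mem_tensorDegree (fun i z hz => add_comm i n ▸ hp i n z y hz hy) hΔx
        · rw [add_comm m]
          exact lTensor_mem_tensorDegree (fun i z hz => add_comm i n ▸ hm i n z y hz hy) hΔx
        · exact rTensor_mem_tensorDegree (fun i z hz => hp m i x z hx hz) hΔy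
        · exact map₂_mem_tensorDegree hp hm hΔx hΔy
      · rintro m n x y ⟨hx, hΔx⟩ ⟨hy, hΔy⟩
        refine ⟨hs _ _ _ _ hx hy, ?_⟩
        rw [h.comul_succ]
        refine add_mem (add_mem (add_mem (add_mem ?_ ?_) ?_) ?_) ?_
        · exact tmul_mem_tensorDegree hy hx (add_comm n m)
        · rw [add_comm m]
          exact rTensor_mem_tensorDegree (fun i z hz => add_comm i n ▸ hs i n z y hz hy) hΔx
        · exact lTensor_mem_tensorDegree (fun i z hz => hm m i x z hx hz) hΔy
        · exact rTensor_mem_tensorDegree (fun i z hz => hs m i x z hx hz) hΔy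
        · exact map₂_mem_tensorDegree hs hm hΔx hΔy
    intro n x hx
    change Δ x ∈ tensorDegree K Ω n
    induction hx using Submodule.span_induction with
    | mem x hx =>
      obtain ⟨a, T, rfl, rfl⟩ := hx
      exact (key T a).2
    | zero => rw [map_zero]; exact zero_mem _
    | add x x' _ _ h h' => rw [map_add]; exact add_mem h h'
    | smul c x _ h => rw [map_smul]; exact Submodule.smul_mem _ _ h

end TreeSpace

end

theorem proposition39 {K : Type*} [Field K] {Ω : Type*} [EDS Ω] (hΩ : EDS.Nondegenerate Ω) :
    (∃! Δ : TreeSpace K Ω →ₗ[K] TreeSpace K Ω ⊗[K] TreeSpace K Ω,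
      IsDendriformBialgebra (K := K) (A := TreeSpace K Ω) (treePrec K Ω) (treeSucc K Ω) Δ ∧
        ∀ α : Ω, Δ (treeBasis K α TypedTree.vertex) = 0) ∧
    ∀ Δ : TreeSpace K Ω →ₗ[K] TreeSpace K Ω ⊗[K] TreeSpace K Ω,
      IsDendriformBialgebra (K := K) (A := TreeSpace K Ω) (treePrec K Ω) (treeSucc K Ω) Δ →
        (∀ α : Ω, Δ (treeBasis K α TypedTree.vertex) = 0) →
          IsDendriformGrading (K := K) (A := TreeSpace K Ω)
            (treePrec K Ω) (treeSucc K Ω) Δ (treeDegree K Ω) := by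
  refine ⟨⟨TreeSpace.reducedComul hΩ,
    ⟨TreeSpace.isDendriformBialgebra hΩ, TreeSpace.reducedComul_vertex hΩ⟩, ?_⟩, ?_⟩
  · rintro Δ ⟨hΔ, hv⟩
    exact TreeSpace.comul_unique hΩ hΔ (TreeSpace.isDendriformBialgebra hΩ)
      fun a => by rw [hv, TreeSpace.reducedComul_vertex]
  · intro Δ hΔ hv
    exact TreeSpace.isDendriformGrading hΩ hΔ hv
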